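/- Let $K$ be an algebraically closed field and let $A$ be a finite-dimensional $K$-algebra (associative, with unit). Modules are finitely generated right $A$-modules unless stated otherwise, and $\mathbb{D}=\mathrm{Hom}_K(-,K)$ is the standard duality between right and left $A$-modules. For a finitely generated right (respectively left) $A$-module $M$ with minimal projective presentation $P_1\to P_0\to M\to 0$, the transpose $\mathrm{Tr}\,M$ is the left (respectively right) $A$-module $\mathrm{Coker}\big(\mathrm{Hom}_A(P_0,A)\to \mathrm{Hom}_A(P_1,A)\big)$; put $\tau T=\mathbb{D}\,\mathrm{Tr}\,T$ and $\tau^{-1}T=\mathrm{Tr}\,\mathbb{D}T$ for a right $A$-module $T$. Let $|T|$ be the number of pairwise nonisomorphic indecomposable direct summands of $T$. A module $T$ is called $\tau$-tilting if $\mathrm{Hom}_A(T,\tau T)=0$ and $|T|=|A|$, and $\tau^{-1}$-tilting if $\mathrm{Hom}_A(\tau^{-1}T,T)=0$ and $|T|=|A|$. Suppose that at least one of the following conditions holds: 1. every $\tau$-tilting $A$-module is $\tau^{-1}$-tilting; 2. every $\tau^{-1}$-tilting $A$-module is $\tau$-tilting. Then $A$ is Iwanaga–Gorenstein, that is, $A$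 has finite injective dimension both as a right and as a left module over itself, and the injective dimension $\mathrm{id}_A A$ of $A$ as a right $A$-module is at most $1$. -/

import Mathlib

open CategoryTheory

universe u w

/-! ### Minimal projective presentations -/

/-- A submodule `N` of `M` is superfluous (small) if `X + N = M` forces `X = M`. -/
def IsSuperfluous (R : Type*) [Ring R] {M : Type*} [AddCommGroup M] [Module R M]
    (N : Submodule R M) : Prop :=
  ∀ X : Submodule R M, X ⊔ N = ⊤ → X = ⊤

/-- A minimal projective presentation `P₁ → P₀ → M → 0` of a left `R`-module `M`: the modules
`P₀`, `P₁` are finitely generated projective, the sequence is exact, and both `P₀ → M` and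
`P₁ → Ker (P₀ → M)` are projective covers, that is, have superfluous kernels. -/
structure MinimalProjectivePresentation (R : Type u) [Ring R]
    (M : Type w) [AddCommGroup M] [Module R M] where
  P₀ : Type u
  P₁ : Type u
  [addCommGroup₀ : AddCommGroup P₀]
  [addCommGroup₁ : AddCommGroup P₁]
  [module₀ : Module R P₀]
  [module₁ : Module R P₁]
  [finite₀ : Module.Finite R P₀]
  [finite₁ : Module.Finite R P₁]
  [projective₀ : Module.Projective R P₀]
  [projective₁ : Module.Projective R P₁]
  d : P₁ →ₗ[R] P₀
  π : P₀ →ₗ[R] M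
  surjective : Function.Surjective π
  exact : Function.Exact d π
  superfluous₀ : IsSuperfluous R (LinearMap.ker π)
  superfluous₁ : IsSuperfluous R (LinearMap.ker d)

namespace MinimalProjectivePresentation

attribute [instance] addCommGroup₀ addCommGroup₁ module₀ module₁ finite₀ finite₁
  projective₀ projective₁

/-- Over a left artinian ring every finitely generated module has a projective cover. -/
theorem exists_projectiveCover (R : Type u) [Ring R] [IsArtinianRing R]
    (M : Type w) [AddCommGroup M] [Module R M] [Module.Finite R M] :
    ∃ (P : Type u) (_ : AddCommGroup P) (_ : Module R P) (f : P →ₗ[R] M),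
      Module.Finite R P ∧ Module.Projective R P ∧ Function.Surjective f ∧
        IsSuperfluous R (LinearMap.ker f) := by
  obtain ⟨n, g, hg⟩ := Module.Finite.exists_fin' R M
  let S : Set (Submodule R (Fin n → R)) :=
    {N | Module.Projective R N ∧ Function.Surjective (g.domRestrict N)}
  have hS : S.Nonempty := by
    refine ⟨⊤, Module.Projective.of_equiv (Submodule.topEquiv (R := R) (M := Fin n → R)).symm, ?_⟩
    intro m
    obtain ⟨x, rfl⟩ := hg m
    exact ⟨⟨x, trivial⟩, rfl⟩
  obtain ⟨N, ⟨hNp, hNs⟩, hmin⟩ := WellFounded.has_min (wellFounded_lt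
    (α := Submodule R (Fin n → R))) S hS
  refine ⟨N, inferInstance, inferInstance, g.domRestrict N, inferInstance, hNp, hNs, ?_⟩
  intro X hX
  set f := g.domRestrict N with hf
  have hXs : Function.Surjective (f.domRestrict X) := by
    intro m
    obtain ⟨y, rfl⟩ := hNs m
    obtain ⟨x, hx, k, hk, rfl⟩ := Submodule.mem_sup.1 (hX ▸ Submodule.mem_top : y ∈ X ⊔ LinearMap.ker f)
    refine ⟨⟨x, hx⟩, ?_⟩
    have : f k = 0 := hk
    simp [this]
  obtain ⟨h, hh⟩ := Module.projective_lifting_property (f.domRestrict X) f hXs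
  let e : Module.End R N := X.subtype ∘ₗ h
  have he : ∀ x, f (e x) = f x := fun x => LinearMap.congr_fun hh x
  have hek : ∀ (k : ℕ) (x), f ((e ^ k) x) = f x := by
    intro k
    induction k with
    | zero => simp
    | succ k ih => intro x; rw [pow_succ', Module.End.mul_apply, he, ih]
  obtain ⟨k, hk1, hk⟩ := ((Filter.eventually_ge_atTop 1).and
    e.eventually_isCompl_ker_pow_range_pow).exists
  have hproj : Module.Projective R (LinearMap.range (e ^ k)) := by
    refine Module.Projective.of_split (LinearMap.range (e ^ k)).subtype
      (Submodule.projectionOnto _ _ hk.symm) ?_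
    ext x
    simp
  have hmem : (LinearMap.range (e ^ k)).map N.subtype ∈ S := by
    refine ⟨Module.Projective.of_equiv
      (Submodule.equivMapOfInjective N.subtype N.injective_subtype (LinearMap.range (e ^ k))), ?_⟩
    intro m
    obtain ⟨y, rfl⟩ := hNs m
    exact ⟨⟨((e ^ k) y : N), ⟨(e ^ k) y, ⟨y, rfl⟩, rfl⟩⟩, hek k y⟩
  have hle : (LinearMap.range (e ^ k)).map N.subtype ≤ N := Submodule.map_subtype_le _ _
  have heq : (LinearMap.range (e ^ k)).map N.subtype = N :=
    eq_of_le_of_not_lt hle (hmin _ hmem)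
  rw [eq_top_iff]
  intro y _
  have hy : (y : Fin n → R) ∈ (LinearMap.range (e ^ k)).map N.subtype := heq.symm ▸ y.2
  obtain ⟨z, ⟨t, rfl⟩, hz⟩ := hy
  have hz' : (e ^ k) t = y := Subtype.ext hz
  obtain ⟨j, rfl⟩ : ∃ j, k = j + 1 := ⟨k - 1, by omega⟩
  rw [← hz', pow_succ', Module.End.mul_apply]
  exact (h ((e ^ j) t)).2

theorem nonempty (R : Type u) [Ring R] [IsArtinianRing R]
    (M : Type w) [AddCommGroup M] [Module R M] [Module.Finite R M] :
    Nonempty (MinimalProjectivePresentation R M) := by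
  obtain ⟨P, _, _, f, _, _, hf, hfs⟩ := exists_projectiveCover R M
  obtain ⟨Q, _, _, g, _, _, hg, hgs⟩ := exists_projectiveCover R (LinearMap.ker f)
  refine ⟨{ P₀ := P, P₁ := Q, d := (LinearMap.ker f).subtype ∘ₗ g, π := f, surjective := hf,
            exact := ?_, superfluous₀ := hfs, superfluous₁ := ?_ }⟩
  · intro x
    constructor
    · intro hx
      obtain ⟨y, hy⟩ := hg ⟨x, hx⟩
      exact ⟨y, by simp [hy]⟩
    · rintro ⟨y, rfl⟩
      exact (g y).2
  · rwa [LinearMap.ker_comp_of_ker_eq_bot _ (Submodule.ker_subtype _)]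

/-- A chosen minimal projective presentation of a finitely generated module over a
finite-dimensional `K`-algebra (minimal projective presentations are unique up to isomorphism). -/
noncomputable def choice (K : Type*) [Field K] (R : Type u) [Ring R] [Algebra K R]
    [Module.Finite K R] (M : Type w) [AddCommGroup M] [Module R M] [Module.Finite R M] :
    MinimalProjectivePresentation R M :=
  haveI : IsArtinianRing R := IsArtinianRing.of_finite K R
  Classical.choice (nonempty R M)

/-- The cokernel of `Hom_R(P₀, U) → Hom_R(P₁, U)`, as a module over `S`, for a minimal projective
presentation `P₁ → P₀ → M → 0` of `M` and a bimodule `U` over `R` and `S`. -/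
abbrev CokerHom {R : Type u} [Ring R] {M : Type w} [AddCommGroup M] [Module R M]
    (p : MinimalProjectivePresentation R M) (S : Type*) [Ring S] (U : Type*) [AddCommGroup U]
    [Module R U] [Module S U] [SMulCommClass R S U] :=
  (p.P₁ →ₗ[R] U) ⧸ LinearMap.range (LinearMap.lcomp S U p.d)

end MinimalProjectivePresentation

/-! ### Auslander–Bridger transpose

Left `A`-modules are `A`-modules, right `A`-modules are `Aᵐᵒᵖ`-modules. -/

section Transpose

variable (K : Type*) [Field K] (A : Type u) [Ring A] [Algebra K A] [Module.Finite K A]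

/-- The transpose `Tr M` of a right `A`-module, a left `A`-module: the cokernel of
`Hom_A(P₀, A) → Hom_A(P₁, A)`. -/
abbrev TrRight (M : Type w) [AddCommGroup M] [Module Aᵐᵒᵖ M] [Module.Finite Aᵐᵒᵖ M] :=
  (MinimalProjectivePresentation.choice K Aᵐᵒᵖ M).CokerHom A A

/-- The transpose `Tr M` of a left `A`-module, a right `A`-module. -/
abbrev TrLeft (M : Type w) [AddCommGroup M] [Module A M] [Module.Finite A M] :=
  (MinimalProjectivePresentation.choice K A M).CokerHom Aᵐᵒᵖ A

end Transpose

/-! ### The standard duality -/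

/-- The underlying additive group of the standard dual `D M = Hom_K(M, K)` of a left `R`-module `M`
over a `K`-algebra `R`: the additive maps `φ : M → K` with `φ (c m) = c φ m` for `c` in `K`, where
`K` acts on `M` through `K → R`. -/
def stdDualSubgroup (K : Type*) [Field K] (R : Type*) [Ring R] [Algebra K R]
    (M : Type*) [AddCommGroup M] [Module R M] : AddSubgroup (M →+ K) where
  carrier := {φ | ∀ (c : K) (m : M), φ (algebraMap K R c • m) = c * φ m}
  add_mem' := fun hφ hψ c m => by
    rw [AddMonoidHom.add_apply, AddMonoidHom.add_apply, hφ c m, hψ c m, mul_add]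
  zero_mem' := fun c m => by simp
  neg_mem' := fun hφ c m => by
    rw [AddMonoidHom.neg_apply, AddMonoidHom.neg_apply, hφ c m, mul_neg]

/-- The standard dual `D M = Hom_K(M, K)`. -/
def StdDual (K : Type*) [Field K] (R : Type*) [Ring R] [Algebra K R]
    (M : Type*) [AddCommGroup M] [Module R M] : Type _ :=
  stdDualSubgroup K R M

namespace StdDual

section

variable {K : Type*} [Field K] {R : Type*} [Ring R] [Algebra K R]
    {M : Type*} [AddCommGroup M] [Module R M]

instance : AddCommGroup (StdDual K R M) :=
  inferInstanceAs (AddCommGroup (stdDualSubgroup K R M))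

instance : FunLike (StdDual K R M) M K where
  coe φ := φ.1
  coe_injective _ _ h := Subtype.ext (DFunLike.coe_injective h)

theorem map_add (φ : StdDual K R M) (m n : M) : φ (m + n) = φ m + φ n :=
  AddMonoidHom.map_add φ.1 m n

theorem map_smul (φ : StdDual K R M) (c : K) (m : M) : φ (algebraMap K R c • m) = c * φ m :=
  φ.2 c m

theorem map_zero (φ : StdDual K R M) : φ 0 = 0 :=
  AddMonoidHom.map_zero φ.1

theorem add_apply (φ ψ : StdDual K R M) (m : M) : (φ + ψ) m = φ m + ψ m := rfl

theorem zero_apply (m : M) : (0 : StdDual K R M) m = 0 := rfl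

/-- The functional `m ↦ φ (r m)`. -/
def precomp (r : R) (φ : StdDual K R M) : StdDual K R M :=
  ⟨{ toFun := fun m => φ (r • m)
     map_zero' := by rw [smul_zero, map_zero]
     map_add' := fun m n => by rw [smul_add, map_add] }, fun c m => by
      change φ (r • algebraMap K R c • m) = c * φ (r • m)
      rw [← map_smul, smul_smul, smul_smul, Algebra.commutes c r]⟩

theorem precomp_apply (r : R) (φ : StdDual K R M) (m : M) : precomp r φ m = φ (r • m) := rfl

/-- The dual of a left `R`-module is a right `R`-module: `(φ r)(m) = φ (r m)`. -/
instance instModuleOp : Module Rᵐᵒᵖ (StdDual K R M) where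
  smul r φ := precomp r.unop φ
  one_smul φ := DFunLike.ext _ _ fun m => congrArg φ (one_smul R m)
  mul_smul r s φ := DFunLike.ext _ _ fun m => congrArg φ (mul_smul s.unop r.unop m)
  smul_zero _ := rfl
  smul_add _ _ _ := rfl
  add_smul r s φ := DFunLike.ext _ _ fun m =>
    (congrArg φ (add_smul r.unop s.unop m)).trans (map_add φ _ _)
  zero_smul φ := DFunLike.ext _ _ fun m =>
    (congrArg φ (zero_smul R m)).trans (map_zero φ)

theorem op_smul_apply (r : R) (φ : StdDual K R M) (m : M) :
    (MulOpposite.op r • φ) m = φ (r • m) := rfl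

instance [Module.Finite K R] [Module.Finite R M] : Module.Finite Rᵐᵒᵖ (StdDual K R M) := by
  let _ : Module K M := Module.compHom M (algebraMap K R)
  have : IsScalarTower K R M := IsScalarTower.of_compHom K R M
  have : Module.Finite K M := Module.Finite.trans R M
  let _ : Module K (StdDual K R M) := Module.compHom _ (algebraMap K Rᵐᵒᵖ)
  have : IsScalarTower K Rᵐᵒᵖ (StdDual K R M) := IsScalarTower.of_compHom K Rᵐᵒᵖ _
  let F : StdDual K R M →ₗ[K] (M →ₗ[K] K) :=
    { toFun := fun φ =>
        { toFun := φ
          map_add' := map_add φ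
          map_smul' := map_smul φ }
      map_add' := fun _ _ => rfl
      map_smul' := fun c φ => LinearMap.ext fun m => map_smul φ c m }
  have hF : Function.Injective F := fun φ ψ h =>
    DFunLike.ext _ _ fun m => LinearMap.congr_fun h m
  have : Module.Finite K (StdDual K R M) := Module.Finite.of_injective F hF
  exact Module.Finite.of_restrictScalars_finite K Rᵐᵒᵖ _

end

section

variable {K : Type*} [Field K] {A : Type*} [Ring A] [Algebra K A]
    {M : Type*} [AddCommGroup M] [Module Aᵐᵒᵖ M]

/-- The dual of a right `A`-module is a left `A`-module: `(a φ)(m) = φ (m a)`. -/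
instance instModuleOfOp : Module A (StdDual K Aᵐᵒᵖ M) :=
  Module.compHom _ (RingEquiv.opOp A).toRingHom

theorem smul_apply (a : A) (φ : StdDual K Aᵐᵒᵖ M) (m : M) :
    (a • φ) m = φ (MulOpposite.op a • m) := rfl

instance [Module.Finite K A] [Module.Finite Aᵐᵒᵖ M] : Module.Finite A (StdDual K Aᵐᵒᵖ M) := by
  obtain ⟨s, hs⟩ := (inferInstance : Module.Finite Aᵐᵒᵖᵐᵒᵖ (StdDual K Aᵐᵒᵖ M))
  refine ⟨s, eq_top_iff.2 fun φ _ => ?_⟩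
  have hφ : φ ∈ Submodule.span Aᵐᵒᵖᵐᵒᵖ (s : Set (StdDual K Aᵐᵒᵖ M)) := hs ▸ Submodule.mem_top
  induction hφ using Submodule.span_induction with
  | mem x hx => exact Submodule.subset_span hx
  | zero => exact Submodule.zero_mem _
  | add x y _ _ hx hy => exact Submodule.add_mem _ (hx trivial) (hy trivial)
  | smul r x _ hx => exact Submodule.smul_mem _ r.unop.unop (hx trivial)

end

end StdDual

/-! ### The number of indecomposable summands -/

/-- An indecomposable module: nonzero, and not the direct sum of two nonzero submodules. -/
def IsIndecomposableModule (R : Type*) [Ring R] (M : Type*) [AddCommGroup M] [Module R M] : Prop :=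
  Nontrivial M ∧ ∀ X Y : Submodule R M, IsCompl X Y → X = ⊥ ∨ Y = ⊥

/-- The indecomposable direct summands of `M`. -/
def IndecSummand (R : Type*) [Ring R] (M : Type*) [AddCommGroup M] [Module R M] :=
  {N : Submodule R M // IsIndecomposableModule R N ∧ ∃ N' : Submodule R M, IsCompl N N'}

/-- Isomorphism of indecomposable direct summands. -/
def indecSummandSetoid (R : Type*) [Ring R] (M : Type*) [AddCommGroup M] [Module R M] :
    Setoid (IndecSummand R M) where
  r X Y := Nonempty (X.1 ≃ₗ[R] Y.1)
  iseqv := ⟨fun _ => ⟨LinearEquiv.refl _ _⟩, fun ⟨e⟩ => ⟨e.symm⟩, fun ⟨e⟩ ⟨f⟩ => ⟨e.trans f⟩⟩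

/-- `|M|`, the number of pairwise nonisomorphic indecomposable direct summands of `M`. -/
noncomputable def numIndecSummands (R : Type*) [Ring R] (M : Type*) [AddCommGroup M]
    [Module R M] : ℕ∞ :=
  ENat.card (Quotient (indecSummandSetoid R M))

/-! ### τ-tilting and τ⁻¹-tilting right modules -/

section Tau

variable (K : Type*) [Field K] (A : Type u) [Ring A] [Algebra K A] [Module.Finite K A]
    (T : Type w) [AddCommGroup T] [Module Aᵐᵒᵖ T] [Module.Finite Aᵐᵒᵖ T]

/-- The Auslander–Reiten translate `τ T = D Tr T` of a right `A`-module `T`. -/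
noncomputable abbrev ARTranslate := StdDual K A (TrRight K A T)

/-- The inverse Auslander–Reiten translate `τ⁻¹ T = Tr D T` of a right `A`-module `T`. -/
noncomputable abbrev InvARTranslate := TrLeft K A (StdDual K Aᵐᵒᵖ T)

/-- `T` is τ-rigid: `Hom_A(T, τ T) = 0`. -/
def IsTauRigid : Prop := ∀ f : T →ₗ[Aᵐᵒᵖ] ARTranslate K A T, f = 0

/-- `T` is τ⁻¹-rigid: `Hom_A(τ⁻¹ T, T) = 0`. -/
def IsTauInvRigid : Prop := ∀ f : InvARTranslate K A T →ₗ[Aᵐᵒᵖ] T, f = 0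

/-- `T` is τ-tilting: it is τ-rigid and `|T| = |A|`. -/
def IsTauTilting : Prop :=
  IsTauRigid K A T ∧ numIndecSummands Aᵐᵒᵖ T = numIndecSummands Aᵐᵒᵖ A

/-- `T` is τ⁻¹-tilting: it is τ⁻¹-rigid and `|T| = |A|`. -/
def IsTauInvTilting : Prop :=
  IsTauInvRigid K A T ∧ numIndecSummands Aᵐᵒᵖ T = numIndecSummands Aᵐᵒᵖ A

end Tau

/-! ### Iwanaga–Gorenstein algebras -/

/-- The injective dimension of `A` as a right module over itself. -/
noncomputable def rightSelfInjDim (A : Type u) [Ring A] : WithBot ℕ∞ :=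
  injectiveDimension (ModuleCat.of.{u} Aᵐᵒᵖ A)

/-- The injective dimension of `A` as a left module over itself. -/
noncomputable def leftSelfInjDim (A : Type u) [Ring A] : WithBot ℕ∞ :=
  injectiveDimension (ModuleCat.of.{u} A A)

/-- `A` is Iwanaga–Gorenstein: both self-injective dimensions are finite. -/
def IsIwanagaGorenstein (A : Type u) [Ring A] : Prop :=
  rightSelfInjDim A < ⊤ ∧ leftSelfInjDim A < ⊤

/-! Each condition is applied to a single module. The regular module `A` is projective, so `τA = 0`
and `A` is `τ`-tilting; dually `𝔻A` is `τ⁻¹`-tilting, and `|𝔻A| = |A|` because both modules have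
endomorphism ring `A`. Hence either `Hom(τ⁻¹A, A) = 0` or `Hom(𝔻A, τ𝔻A) = 0`. If `d : P₁ → P₀` is a
minimal presentation of `M`, every element of `Ker d` gives by evaluation a homomorphism `Tr M → A`,
so either vanishing makes `d` injective (`MinimalProjectivePresentation.injective_d`). Thus the dual
of the regular module has projective dimension at most one, over left modules in the first case and
over right modules in the second. Dualizing this resolution bounds the self-injective dimension on
the opposite side (`injectiveDimension_le_one_of_dual`).

The bound on the same side is `ProjectiveHom.injectiveDimension_self_le_one`. Let `T` be an
injective cogenerator over `R` of projective dimension at most one. Bongartz's universal extension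
`0 → R → E → Tⁿ → 0` satisfies `Ext¹(T, E) = 0 = Ext¹(E, E)`, and it is an injective coresolution of
`R` as soon as `E` is injective. For each simple module `Sᵢ` choose a summand `Iᵢ` of `T` whose
simple submodules are all isomorphic to `Sᵢ`. The modules `Iᵢ` and `E` are mutually rigid and are
one more in number than the simple modules, so their classes in the Grothendieck group of
projectives satisfy a nontrivial integral relation. Rigid modules are determined by these classes,
so the relation becomes an isomorphism of direct sums. Comparing simple submodules shows that the
relation involves `E`; then `E` is a summand of a sum of modules `Iᵢ`, hence injective.

That classes determine rigid modules is an open orbit argument. If every map `P → Coker f` extends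
along `f : P → Q`, the orbit of `f` under `Aut P × Aut Q` has full tangent space in `Hom(P, Q)`. Two
such homomorphisms are both equivalent to a general point of the line joining them, hence to each
other. The geometry reduces to nonvanishing of polynomials in one variable over an infinite field.
-/

/-! ### Polynomial curves and open orbits -/

section OpenOrbit

open Polynomial

variable {K : Type*} [Field K]

/-- A curve in a vector space all of whose coordinates are polynomial functions. -/
def IsPolynomialCurve {V : Type*} [AddCommGroup V] [Module K V] (φ : K → V) : Prop :=
  ∀ l : V →ₗ[K] K, ∃ p : K[X], ∀ t, l (φ t) = p.eval t

theorem IsPolynomialCurve.map {V W : Type*} [AddCommGroup V] [Module K V] [AddCommGroup W]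
    [Module K W] {φ : K → V} (h : IsPolynomialCurve φ) (L : V →ₗ[K] W) :
    IsPolynomialCurve fun t => L (φ t) :=
  fun l => h (l ∘ₗ L)

theorem IsPolynomialCurve.exists_det {V : Type*} [AddCommGroup V] [Module K V]
    [Module.Finite K V] {φ : K → Module.End K V} (h : IsPolynomialCurve φ) :
    ∃ p : K[X], ∀ t, LinearMap.det (φ t) = p.eval t := by
  let b := Module.finBasis K V
  have key : ∀ i j, ∃ p : K[X], ∀ t, LinearMap.toMatrix b b (φ t) i j = p.eval t := fun i j =>
    h (Matrix.entryLinearMap K K i j ∘ₗ (LinearMap.toMatrix b b).toLinearMap)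
  choose p hp using key
  refine ⟨(Matrix.of p).det, fun t => ?_⟩
  rw [← LinearMap.det_toMatrix b, ← Polynomial.coe_evalRingHom, RingHom.map_det]
  congr 1
  ext i j
  simp [hp]

/-- If `L₀` is surjective, then every kernel vector of `L₀` extends to a polynomial curve of kernel
vectors of `L₀ + t L₁`. -/
theorem exists_isPolynomialCurve_ker {V W : Type*} [AddCommGroup V] [Module K V] [AddCommGroup W]
    [Module K W] [Module.Finite K W] (L₀ L₁ : V →ₗ[K] W) (hL : Function.Surjective L₀) (v : V)
    (hv : L₀ v = 0) :
    ∃ φ : K → V, IsPolynomialCurve φ ∧ φ 0 = v ∧ ∀ t, L₀ (φ t) + t • L₁ (φ t) = 0 := by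
  obtain ⟨s, hs⟩ := LinearMap.exists_rightInverse_of_surjective L₀ (LinearMap.range_eq_top.2 hL)
  have hs' : ∀ w, L₀ (s w) = w := fun w => LinearMap.congr_fun hs w
  let b := Module.finBasis K W
  let N := LinearMap.toMatrix b b (L₁ ∘ₗ s)
  let M : K → Matrix _ _ K := fun t => 1 + t • N
  let u := b.equivFun (L₁ v)
  -- Cramer's rule: `x t` solves `(1 + t L₁ s) x = det (M t) • L₁ v`. Using the adjugate instead of
  -- the inverse keeps it polynomial in `t`.
  let x : K → W := fun t => b.equivFun.symm ((M t).adjugate.mulVec u)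
  let Mp : Matrix (Fin (Module.finrank K W)) (Fin (Module.finrank K W)) K[X] :=
    1 + (X : K[X]) • N.map C
  have hMp : ∀ t, (evalRingHom t).mapMatrix Mp = M t := by
    intro t
    ext i j
    by_cases hij : i = j <;> simp [Mp, M, hij] <;> ring
  have hx : ∀ t, x t + t • L₁ (s (x t)) = (M t).det • L₁ v := by
    intro t
    apply b.equivFun.injective
    have h1 : b.equivFun (L₁ (s (x t))) = N.mulVec ((M t).adjugate.mulVec u) := by
      have := LinearMap.toMatrix_mulVec_repr b b (L₁ ∘ₗ s) (x t)
      rw [← Module.Basis.equivFun_apply, ← Module.Basis.equivFun_apply] at this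
      rw [← LinearMap.comp_apply, ← this]
      have hxt : b.equivFun (x t) = (M t).adjugate.mulVec u := LinearEquiv.apply_symm_apply _ _
      rw [hxt]
    rw [_root_.map_add, _root_.map_smul, h1, _root_.map_smul]
    change b.equivFun (b.equivFun.symm _) + _ = (M t).det • u
    rw [LinearEquiv.apply_symm_apply]
    calc (M t).adjugate.mulVec u + t • N.mulVec ((M t).adjugate.mulVec u)
        = (M t).mulVec ((M t).adjugate.mulVec u) := by
          simp only [M, Matrix.add_mulVec, Matrix.one_mulVec, Matrix.smul_mulVec]
      _ = (M t).det • u := by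
          rw [Matrix.mulVec_mulVec, Matrix.mul_adjugate, Matrix.smul_mulVec, Matrix.one_mulVec]
  -- The vector `v` is scaled by the same determinant, which is `1` at `t = 0`, so the curve starts
  -- at `v`.
  refine ⟨fun t => (M t).det • v - t • s (x t), fun l => ?_, ?_, fun t => ?_⟩
  · refine ⟨Mp.det * C (l v) -
      X * ∑ i, (∑ j, Mp.adjugate i j * C (u j)) * C (l (s (b i))), fun t => ?_⟩
    have h1 : eval t Mp.det = (M t).det := by
      rw [← hMp, ← RingHom.map_det, coe_evalRingHom]
    have h2 : ∀ i j, eval t (Mp.adjugate i j) = (M t).adjugate i j := by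
      intro i j
      rw [← hMp, ← RingHom.map_adjugate, RingHom.mapMatrix_apply, Matrix.map_apply,
        coe_evalRingHom]
    have h3 : l (s (x t)) = ∑ i, (∑ j, (M t).adjugate i j * u j) * l (s (b i)) := by
      simp only [x, Module.Basis.equivFun_symm_apply, _root_.map_sum, _root_.map_smul, smul_eq_mul,
        Matrix.mulVec, dotProduct]
    simp only [_root_.map_sub, _root_.map_smul, smul_eq_mul, h3, eval_sub, eval_mul, eval_X,
      eval_C, h1, eval_finsetSum, h2]
  · simp [M]
  · have := hx t
    simp only [_root_.map_sub, _root_.map_smul, hv, hs', smul_zero, zero_sub]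
    rw [smul_sub, smul_comm t (M t).det, smul_comm (M t).det t, ← this]
    module

variable {R : Type*} [Ring R] [Algebra K R]
  {P Q : Type*} [AddCommGroup P] [AddCommGroup Q] [Module R P] [Module R Q]
  [Module K P] [Module K Q] [IsScalarTower K R P] [IsScalarTower K R Q]

theorem finite_linearMap (K : Type*) [Field K] (R : Type*) [Ring R] [Algebra K R]
    (P Q : Type*) [AddCommGroup P] [AddCommGroup Q] [Module R P] [Module R Q]
    [Module K P] [Module K Q] [IsScalarTower K R P] [IsScalarTower K R Q]
    [Module.Finite K P] [Module.Finite K Q] : Module.Finite K (P →ₗ[R] Q) :=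
  Module.Finite.of_injective (LinearMap.restrictScalarsₗ K R P Q K)
    (LinearMap.restrictScalars_injective K)

theorem exists_linearEquiv_of_det_ne_zero [Module.Finite K P] (a : P →ₗ[R] P)
    (h : LinearMap.det (a.restrictScalars K) ≠ 0) : ∃ e : P ≃ₗ[R] P, e.toLinearMap = a := by
  have hu : IsUnit (a.restrictScalars K) := (LinearMap.isUnit_iff_isUnit_det _).2 h.isUnit
  refine ⟨LinearEquiv.ofBijective a ((Module.End.isUnit_iff (a.restrictScalars K)).1 hu), rfl⟩

/-- On the line through `f` and `g`, almost all points are equivalent to `f` if the orbit of `f` has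
full tangent space. -/
theorem exists_polynomial_equivalent [Module.Finite K P] [Module.Finite K Q] (f g : P →ₗ[R] Q)
    (hf : ∀ h : P →ₗ[R] Q, ∃ (a : P →ₗ[R] P) (b : Q →ₗ[R] Q), h = f ∘ₗ a - b ∘ₗ f) :
    ∃ p : K[X], p ≠ 0 ∧ ∀ t, p.eval t ≠ 0 →
      ∃ (a : P ≃ₗ[R] P) (b : Q ≃ₗ[R] Q), b.toLinearMap ∘ₗ f = (f + t • g) ∘ₗ a.toLinearMap := by
  have : Module.Finite K (P →ₗ[R] Q) := finite_linearMap K R P Q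
  -- The kernel of `L₀ + t L₁` consists of the pairs `(a, b)` with `(f + t g) a = b f`. The curve of
  -- such pairs starts at `(id, id)`.
  let L₀ : (P →ₗ[R] P) × (Q →ₗ[R] Q) →ₗ[K] (P →ₗ[R] Q) :=
    { toFun := fun v => f ∘ₗ v.1 - v.2 ∘ₗ f
      map_add' := fun v w => by ext x; simp; abel
      map_smul' := fun c v => by
        ext x
        simp only [Prod.smul_fst, Prod.smul_snd, LinearMap.sub_apply, LinearMap.comp_apply,
          LinearMap.smul_apply, LinearMap.map_smul_of_tower, RingHom.id_apply, smul_sub] }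
  let L₁ : (P →ₗ[R] P) × (Q →ₗ[R] Q) →ₗ[K] (P →ₗ[R] Q) :=
    { toFun := fun v => g ∘ₗ v.1
      map_add' := fun v w => by ext x; simp
      map_smul' := fun c v => by
        ext x
        simp only [Prod.smul_fst, LinearMap.comp_apply,
          LinearMap.smul_apply, LinearMap.map_smul_of_tower, RingHom.id_apply] }
  obtain ⟨φ, hφ, hφ0, hφL⟩ := exists_isPolynomialCurve_ker L₀ L₁
    (fun h => by
      obtain ⟨a, b, hab⟩ := hf h
      exact ⟨(a, b), hab.symm⟩) (LinearMap.id, LinearMap.id) (by simp [L₀])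
  obtain ⟨p, hp⟩ := (hφ.map (LinearMap.restrictScalarsₗ K R P P K ∘ₗ
    LinearMap.fst K _ _)).exists_det
  obtain ⟨q, hq⟩ := (hφ.map (LinearMap.restrictScalarsₗ K R Q Q K ∘ₗ
    LinearMap.snd K _ _)).exists_det
  -- Both determinants equal `1` at `t = 0`, and both components are invertible wherever `p * q`
  -- does not vanish.
  refine ⟨p * q, ?_, fun t ht => ?_⟩
  · intro h0
    have h1 := congrArg (Polynomial.eval 0) h0
    rw [eval_mul, ← hp, ← hq, hφ0] at h1
    have e1 : (LinearMap.restrictScalarsₗ K R P P K ∘ₗ LinearMap.fst K _ _)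
      ((LinearMap.id : P →ₗ[R] P), (LinearMap.id : Q →ₗ[R] Q)) = LinearMap.id := rfl
    have e2 : (LinearMap.restrictScalarsₗ K R Q Q K ∘ₗ LinearMap.snd K _ _)
      ((LinearMap.id : P →ₗ[R] P), (LinearMap.id : Q →ₗ[R] Q)) = LinearMap.id := rfl
    rw [e1, e2] at h1
    simp at h1
  · rw [eval_mul, ← hp, ← hq] at ht
    obtain ⟨a, ha⟩ := exists_linearEquiv_of_det_ne_zero (φ t).1 (left_ne_zero_of_mul ht)
    obtain ⟨b, hb⟩ := exists_linearEquiv_of_det_ne_zero (φ t).2 (right_ne_zero_of_mul ht)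
    refine ⟨a, b, ?_⟩
    rw [ha, hb]
    have h1 : (f ∘ₗ (φ t).1 - (φ t).2 ∘ₗ f) + t • (g ∘ₗ (φ t).1) = 0 := hφL t
    ext x
    have h2 := LinearMap.congr_fun h1 x
    simp only [LinearMap.add_apply, LinearMap.sub_apply, LinearMap.smul_apply,
      LinearMap.comp_apply, LinearMap.zero_apply] at h2 ⊢
    rw [sub_add_eq_add_sub, sub_eq_zero] at h2
    exact h2.symm

/-- Two homomorphisms whose orbits have full tangent spaces are equivalent. -/
theorem exists_equivalence_of_openOrbits [Infinite K] [Module.Finite K P] [Module.Finite K Q]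
    (f g : P →ₗ[R] Q)
    (hf : ∀ h : P →ₗ[R] Q, ∃ (a : P →ₗ[R] P) (b : Q →ₗ[R] Q), h = f ∘ₗ a - b ∘ₗ f)
    (hg : ∀ h : P →ₗ[R] Q, ∃ (a : P →ₗ[R] P) (b : Q →ₗ[R] Q), h = g ∘ₗ a - b ∘ₗ g) :
    ∃ (a : P ≃ₗ[R] P) (b : Q ≃ₗ[R] Q), b.toLinearMap ∘ₗ f = g ∘ₗ a.toLinearMap := by
  obtain ⟨p, hp0, hp⟩ := exists_polynomial_equivalent (K := K) f (g - f) hf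
  obtain ⟨q, hq0, hq⟩ := exists_polynomial_equivalent (K := K) g (f - g) hg
  -- The same line is traversed from both ends: the parameter `t` measured from `f` is `1 - t`
  -- measured from `g`.
  have hne : p * q.comp (1 - X) ≠ 0 := by
    refine mul_ne_zero hp0 fun h => hq0 ?_
    have h1 := congrArg (fun r => r.comp (1 - X : K[X])) h
    simpa [comp_assoc] using h1
  obtain ⟨t, ht⟩ : ∃ t, eval t (p * q.comp (1 - X)) ≠ 0 := by
    by_contra! h
    exact hne (Polynomial.funext fun t => by simp [h t])
  rw [eval_mul, eval_comp, eval_sub, eval_one, eval_X] at ht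
  obtain ⟨a, b, hab⟩ := hp t (left_ne_zero_of_mul ht)
  obtain ⟨a', b', hab'⟩ := hq (1 - t) (right_ne_zero_of_mul ht)
  have hfg : g + (1 - t) • (f - g) = f + t • (g - f) := by module
  rw [hfg] at hab'
  refine ⟨a.trans a'.symm, b.trans b'.symm, ?_⟩
  ext x
  have h1 := LinearMap.congr_fun hab x
  have h2 := LinearMap.congr_fun hab' (a'.symm (a x))
  simp only [LinearMap.comp_apply, LinearEquiv.coe_coe, LinearEquiv.apply_symm_apply] at h1 h2
  simp only [LinearMap.comp_apply, LinearEquiv.coe_coe, LinearEquiv.trans_apply]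
  rw [h1, ← h2, LinearEquiv.symm_apply_apply]

end OpenOrbit

/-! ### Rigid presentations -/

section RigidPresentation

variable {R : Type*} [Ring R]

theorem exists_lift_of_exact {M P Q X : Type*} [AddCommGroup M] [AddCommGroup P] [AddCommGroup Q]
    [AddCommGroup X] [Module R M] [Module R P] [Module R Q] [Module R X] [Module.Projective R M]
    {f : P →ₗ[R] Q} {π : Q →ₗ[R] X} (hex : Function.Exact f π) (g : M →ₗ[R] Q)
    (hg : π ∘ₗ g = 0) : ∃ a : M →ₗ[R] P, f ∘ₗ a = g := by
  have hg' : ∀ x, g x ∈ LinearMap.range f := fun x => (hex (g x)).1 (LinearMap.congr_fun hg x)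
  obtain ⟨a, ha⟩ := Module.projective_lifting_property f.rangeRestrict
    (g.codRestrict (LinearMap.range f) hg') f.surjective_rangeRestrict
  refine ⟨a, LinearMap.ext fun x => ?_⟩
  exact congrArg Subtype.val (LinearMap.congr_fun ha x)

variable {P Q X : Type*} [AddCommGroup P] [AddCommGroup Q] [AddCommGroup X]
  [Module R P] [Module R Q] [Module R X]

/-- Extending `π h` along `f` and lifting the result to `Q` gives `b` such that `h - b f` is killed
by `π`, hence factors through `f`. The maps `f a - b f` form the tangent space to the orbit of `f`.
-/
theorem tangent_surjective_of_extends [Module.Projective R P] [Module.Projective R Q]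
    {f : P →ₗ[R] Q} {π : Q →ₗ[R] X} (hπ : Function.Surjective π) (hex : Function.Exact f π)
    (hext : ∀ φ : P →ₗ[R] X, ∃ k : Q →ₗ[R] X, k ∘ₗ f = φ) (h : P →ₗ[R] Q) :
    ∃ (a : P →ₗ[R] P) (b : Q →ₗ[R] Q), h = f ∘ₗ a - b ∘ₗ f := by
  obtain ⟨k, hk⟩ := hext (π ∘ₗ h)
  obtain ⟨b, hb⟩ := Module.projective_lifting_property π k hπ
  obtain ⟨a, ha⟩ := exists_lift_of_exact hex (h - b ∘ₗ f) (by
    rw [LinearMap.comp_sub, ← LinearMap.comp_assoc, hb, hk, sub_self])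
  exact ⟨a, -b, by rw [ha, LinearMap.neg_comp]; abel⟩

/-- Both orbits have full tangent space, so `f` and `g` are equivalent; an equivalence matches the
images and therefore the cokernels. -/
theorem nonempty_equiv_of_extends (K : Type*) [Field K] [Infinite K] [Algebra K R] [Module.Finite K R]
    [Module.Projective R P] [Module.Projective R Q]
    [Module.Finite R P] [Module.Finite R Q]
    {Y : Type*} [AddCommGroup Y] [Module R Y]
    {f g : P →ₗ[R] Q} {π : Q →ₗ[R] X} {ρ : Q →ₗ[R] Y}
    (hπ : Function.Surjective π) (hfπ : Function.Exact f π)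
    (hf : ∀ φ : P →ₗ[R] X, ∃ k : Q →ₗ[R] X, k ∘ₗ f = φ)
    (hρ : Function.Surjective ρ) (hgρ : Function.Exact g ρ)
    (hg : ∀ φ : P →ₗ[R] Y, ∃ k : Q →ₗ[R] Y, k ∘ₗ g = φ) : Nonempty (X ≃ₗ[R] Y) := by
  let _ : Module K P := Module.compHom P (algebraMap K R)
  let _ : Module K Q := Module.compHom Q (algebraMap K R)
  have : IsScalarTower K R P := IsScalarTower.of_compHom K R P
  have : IsScalarTower K R Q := IsScalarTower.of_compHom K R Q
  have : Module.Finite K P := Module.Finite.trans R P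
  have : Module.Finite K Q := Module.Finite.trans R Q
  obtain ⟨a, b, hab⟩ := exists_equivalence_of_openOrbits (K := K) f g
    (tangent_surjective_of_extends hπ hfπ hf) (tangent_surjective_of_extends hρ hgρ hg)
  have hmap : (LinearMap.ker π).map b.toLinearMap = LinearMap.ker ρ := by
    rw [LinearMap.exact_iff.1 hfπ, LinearMap.exact_iff.1 hgρ, ← LinearMap.range_comp, hab,
      LinearMap.range_comp_of_range_eq_top _ (LinearEquiv.range a)]
  exact ⟨(π.quotKerEquivOfSurjective hπ).symm.trans
    ((Submodule.Quotient.equiv _ _ b hmap).trans (ρ.quotKerEquivOfSurjective hρ))⟩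

/-- Modules with rigid presentations whose terms agree stably are isomorphic. -/
theorem nonempty_equiv_of_rigid (K : Type*) [Field K] [Infinite K] [Algebra K R] [Module.Finite K R]
    [Module.Projective R P] [Module.Projective R Q]
    [Module.Finite R P] [Module.Finite R Q]
    {P' Q' Y : Type*} [AddCommGroup P'] [AddCommGroup Q'] [AddCommGroup Y]
    [Module R P'] [Module R Q'] [Module R Y] [Module.Projective R P'] [Module.Projective R Q']
    [Module.Finite R P'] [Module.Finite R Q'] (e : (Q × P') ≃ₗ[R] (Q' × P))
    {f : P →ₗ[R] Q} {π : Q →ₗ[R] X} {g : P' →ₗ[R] Q'} {ρ : Q' →ₗ[R] Y}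
    (hπ : Function.Surjective π) (hfπ : Function.Exact f π)
    (hf : ∀ φ : P →ₗ[R] X, ∃ k : Q →ₗ[R] X, k ∘ₗ f = φ)
    (hρ : Function.Surjective ρ) (hgρ : Function.Exact g ρ)
    (hg : ∀ φ : P' →ₗ[R] Y, ∃ k : Q' →ₗ[R] Y, k ∘ₗ g = φ) : Nonempty (X ≃ₗ[R] Y) := by
  -- Adding an identity map changes neither the cokernel nor the extension property. After this, `e`
  -- lets both presentations have the same terms.
  let F : (P × P') →ₗ[R] (Q × P') := f.prodMap LinearMap.id
  let G : (P × P') →ₗ[R] (Q × P') :=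
    e.symm.toLinearMap ∘ₗ (g.prodMap LinearMap.id) ∘ₗ (LinearEquiv.prodComm R P P').toLinearMap
  refine nonempty_equiv_of_extends K (f := F) (g := G) (π := π ∘ₗ LinearMap.fst R Q P')
    (ρ := ρ ∘ₗ LinearMap.fst R Q' P ∘ₗ e.toLinearMap) ?_ ?_ ?_ ?_ ?_ ?_
  · exact hπ.comp Prod.fst_surjective
  · rintro ⟨q, p'⟩
    simp only [LinearMap.comp_apply, LinearMap.fst_apply, F]
    rw [hfπ q]
    constructor
    · rintro ⟨p, rfl⟩
      exact ⟨(p, p'), rfl⟩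
    · rintro ⟨⟨p, p''⟩, h⟩
      exact ⟨p, congrArg Prod.fst h⟩
  · intro φ
    obtain ⟨k, hk⟩ := hf (φ ∘ₗ LinearMap.inl R P P')
    refine ⟨k.coprod (φ ∘ₗ LinearMap.inr R P P'), ?_⟩
    refine LinearMap.prod_ext ?_ ?_
    · rw [← hk]; ext x; simp [F, ← Prod.zero_eq_mk]
    · ext x; simp [F]
  · exact hρ.comp (Prod.fst_surjective.comp e.surjective)
  · intro x
    simp only [LinearMap.comp_apply, LinearMap.fst_apply, LinearEquiv.coe_coe, G]
    rw [hgρ (e x).1]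
    constructor
    · rintro ⟨p, hp⟩
      refine ⟨((e x).2, p), ?_⟩
      simp only [LinearMap.comp_apply, LinearEquiv.coe_coe, LinearEquiv.prodComm_apply,
        Prod.swap_prod_mk, LinearMap.prodMap_apply, LinearMap.id_apply]
      rw [hp, LinearEquiv.symm_apply_apply]
    · rintro ⟨⟨p, p'⟩, h⟩
      refine ⟨p', ?_⟩
      rw [← h]
      simp
  · intro φ
    obtain ⟨k, hk⟩ := hg (φ ∘ₗ LinearMap.inr R P P')
    refine ⟨k.coprod (φ ∘ₗ LinearMap.inl R P P') ∘ₗ e.toLinearMap, ?_⟩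
    refine LinearMap.prod_ext ?_ ?_
    · ext x; simp [G]
    · rw [← hk]; ext x; simp [G, ← Prod.zero_eq_mk]

end RigidPresentation

/-! ### Projective modules are determined by their tops -/

section Projective

theorem exists_equiv_prod_ker_of_surjective {R : Type*} [Ring R] {Q P : Type*} [AddCommGroup Q]
    [AddCommGroup P] [Module R Q] [Module R P] [Module.Projective R P] (r : Q →ₗ[R] P)
    (hr : Function.Surjective r) : Nonempty (Q ≃ₗ[R] P × LinearMap.ker r) := by
  obtain ⟨s, hs⟩ := Module.projective_lifting_property r LinearMap.id hr
  have hs' : ∀ p, r (s p) = p := fun p => LinearMap.congr_fun hs p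
  refine ⟨(LinearEquiv.ofBijective (s.coprod (LinearMap.ker r).subtype) ⟨?_, ?_⟩).symm⟩
  · rw [← LinearMap.ker_eq_bot, LinearMap.ker_eq_bot']
    rintro ⟨p, k⟩ h
    have h' : s p + k = 0 := h
    have hp : p = 0 := by
      have := congrArg r h'
      rwa [_root_.map_add, hs', k.2, add_zero, _root_.map_zero] at this
    subst hp
    rw [_root_.map_zero, zero_add] at h'
    ext
    · rfl
    · exact h'
  · intro q
    exact ⟨(r q, ⟨q - s (r q), by simp [hs']⟩), by simp⟩

variable {R : Type u} [Ring R]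

theorem surjective_of_superfluous_ker {Q P S : Type*} [AddCommGroup Q] [AddCommGroup P]
    [AddCommGroup S] [Module R Q] [Module R P] [Module R S] {π : P →ₗ[R] S}
    (hs : IsSuperfluous R (LinearMap.ker π)) (r : Q →ₗ[R] P)
    (hr : Function.Surjective (π ∘ₗ r)) : Function.Surjective r := by
  rw [← LinearMap.range_eq_top]
  apply hs
  rw [eq_top_iff]
  intro p _
  obtain ⟨q, hq⟩ := hr (π p)
  refine Submodule.mem_sup.2 ⟨r q, ⟨q, rfl⟩, p - r q, ?_, by abel⟩
  rw [LinearMap.mem_ker, _root_.map_sub, ← hq, LinearMap.comp_apply, sub_self]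

variable (K : Type*) [Field K] [Algebra K R]

theorem finrank_hom_prod [Module.Finite K R] (P Q S : Type*) [AddCommGroup P] [AddCommGroup Q] [AddCommGroup S]
    [Module R P] [Module R Q] [Module R S] [Module K S] [IsScalarTower K R S]
    [Module.Finite R P] [Module.Finite R Q] [Module.Finite R S] :
    Module.finrank K (P × Q →ₗ[R] S) =
      Module.finrank K (P →ₗ[R] S) + Module.finrank K (Q →ₗ[R] S) := by
  let _ : Module K P := Module.compHom P (algebraMap K R)
  let _ : Module K Q := Module.compHom Q (algebraMap K R)
  have : IsScalarTower K R P := IsScalarTower.of_compHom K R P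
  have : IsScalarTower K R Q := IsScalarTower.of_compHom K R Q
  have : Module.Finite K P := Module.Finite.trans R P
  have : Module.Finite K Q := Module.Finite.trans R Q
  have : Module.Finite K S := Module.Finite.trans R S
  have := finite_linearMap K R P S
  have := finite_linearMap K R Q S
  rw [← Module.finrank_prod]
  exact (LinearMap.coprodEquiv (R := R) K).finrank_eq.symm

theorem finrank_hom_congr {P Q : Type*} (S : Type*) [AddCommGroup P] [AddCommGroup Q]
    [AddCommGroup S] [Module R P] [Module R Q] [Module R S] [Module K S] [IsScalarTower K R S]
    (e : P ≃ₗ[R] Q) :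
    Module.finrank K (P →ₗ[R] S) = Module.finrank K (Q →ₗ[R] S) :=
  LinearEquiv.finrank_eq
    { toFun := fun f => f ∘ₗ e.symm.toLinearMap
      invFun := fun f => f ∘ₗ e.toLinearMap
      map_add' := fun _ _ => rfl
      map_smul' := fun _ _ => rfl
      left_inv := fun f => by ext; simp
      right_inv := fun f => by ext; simp }

theorem exists_surjective_to_simple {ι : Type*} {S : ι → Type u} [∀ i, AddCommGroup (S i)]
    [∀ i, Module R (S i)]
    (hS : ∀ (M : Type u) [AddCommGroup M] [Module R M], IsSimpleModule R M →
      ∃ i, Nonempty (M ≃ₗ[R] S i))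
    (Q : Type u) [AddCommGroup Q] [Module R Q] [Module.Finite R Q] [Nontrivial Q] :
    ∃ i, ∃ q : Q →ₗ[R] S i, Function.Surjective q := by
  obtain ⟨N, hN, -⟩ := (eq_top_or_exists_le_coatom (⊥ : Submodule R Q)).resolve_left bot_ne_top
  obtain ⟨i, ⟨e⟩⟩ := hS (Q ⧸ N) (isSimpleModule_iff_isCoatom.2 hN)
  exact ⟨i, e.toLinearMap ∘ₗ N.mkQ, e.surjective.comp N.mkQ_surjective⟩

theorem exists_surjective_of_finrank_hom_ne_zero (Q S : Type*) [AddCommGroup Q] [AddCommGroup S]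
    [Module R Q] [Module R S] [Module K S] [IsScalarTower K R S] [IsSimpleModule R S]
    (h : Module.finrank K (Q →ₗ[R] S) ≠ 0) :
    ∃ q : Q →ₗ[R] S, Function.Surjective q := by
  obtain ⟨q, hq⟩ : ∃ q : Q →ₗ[R] S, q ≠ 0 := by
    by_contra! h0
    have : Subsingleton (Q →ₗ[R] S) := ⟨fun a b => by rw [h0 a, h0 b]⟩
    exact h Module.finrank_zero_of_subsingleton
  exact ⟨q, LinearMap.surjective_of_ne_zero hq⟩

theorem finrank_hom_pos [Module.Finite K R] (Q S : Type*) [AddCommGroup Q] [AddCommGroup S]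
    [Module R Q] [Module R S] [Module K S] [IsScalarTower K R S] [Module.Finite R Q]
    [Module.Finite R S] (q : Q →ₗ[R] S) (hq : q ≠ 0) : 0 < Module.finrank K (Q →ₗ[R] S) := by
  let _ : Module K Q := Module.compHom Q (algebraMap K R)
  have : IsScalarTower K R Q := IsScalarTower.of_compHom K R Q
  have : Module.Finite K Q := Module.Finite.trans R Q
  have : Module.Finite K S := Module.Finite.trans R S
  have := finite_linearMap K R Q S
  have : Nontrivial (Q →ₗ[R] S) := ⟨q, 0, hq⟩
  exact Module.finrank_pos

/-- Finitely generated projective modules with the same multiplicities of simple modules in their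
tops are isomorphic. -/
theorem nonempty_equiv_of_finrank_hom_eq [Module.Finite K R] {ι : Type*} {S : ι → Type u} [∀ i, AddCommGroup (S i)]
    [∀ i, Module R (S i)] [∀ i, Module K (S i)] [∀ i, IsScalarTower K R (S i)]
    [∀ i, IsSimpleModule R (S i)]
    (hS : ∀ (M : Type u) [AddCommGroup M] [Module R M], IsSimpleModule R M →
      ∃ i, Nonempty (M ≃ₗ[R] S i)) (n : ℕ) :
    ∀ (Q Q' : Type u) [AddCommGroup Q] [AddCommGroup Q'] [Module R Q] [Module R Q']
      [Module K Q] [IsScalarTower K R Q] [Module.Finite R Q] [Module.Finite R Q']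
      [Module.Projective R Q] [Module.Projective R Q'], Module.finrank K Q = n →
      (∀ i, Module.finrank K (Q →ₗ[R] S i) = Module.finrank K (Q' →ₗ[R] S i)) →
      Nonempty (Q ≃ₗ[R] Q') := by
  induction n using Nat.strong_induction_on with
  | _ n ih =>
    intro Q Q' _ _ _ _ _ _ _ _ _ _ hn h
    rcases subsingleton_or_nontrivial Q with hQ | hQ
    · rcases subsingleton_or_nontrivial Q' with hQ' | hQ'
      · exact ⟨0⟩
      · obtain ⟨i, q, hq⟩ := exists_surjective_to_simple hS Q'
        have hq0 : q ≠ 0 := by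
          rintro rfl
          have := IsSimpleModule.nontrivial R (S i)
          obtain ⟨x, hx⟩ := exists_ne (0 : S i)
          obtain ⟨y, hy⟩ := hq x
          exact hx hy.symm
        have h1 := finrank_hom_pos K Q' (S i) q hq0
        rw [← h i] at h1
        have : Subsingleton (Q →ₗ[R] S i) :=
          ⟨fun a b => LinearMap.ext fun x => by rw [Subsingleton.elim x 0]; simp⟩
        exact absurd Module.finrank_zero_of_subsingleton h1.ne'
    · obtain ⟨i, q, hq⟩ := exists_surjective_to_simple hS Q
      have hnt := IsSimpleModule.nontrivial R (S i)
      have hq0 : q ≠ 0 := by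
        rintro rfl
        obtain ⟨x, hx⟩ := exists_ne (0 : S i)
        obtain ⟨y, hy⟩ := hq x
        exact hx hy.symm
      have h1 := finrank_hom_pos K Q (S i) q hq0
      obtain ⟨q', hq'⟩ := exists_surjective_of_finrank_hom_ne_zero K Q' (S i) (h i ▸ h1.ne')
      have : IsArtinianRing R := IsArtinianRing.of_finite K R
      -- The projective cover of a common simple quotient splits off both modules. The complements
      -- again have equal multiplicities, and the first has smaller dimension.
      obtain ⟨P, _, _, π, _, _, hπ, hs⟩ :=
        MinimalProjectivePresentation.exists_projectiveCover R (S i)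
      obtain ⟨r, hr⟩ := Module.projective_lifting_property π q hπ
      obtain ⟨r', hr'⟩ := Module.projective_lifting_property π q' hπ
      obtain ⟨e⟩ := exists_equiv_prod_ker_of_surjective r
        (surjective_of_superfluous_ker hs r (hr ▸ hq))
      obtain ⟨e'⟩ := exists_equiv_prod_ker_of_surjective r'
        (surjective_of_superfluous_ker hs r' (hr' ▸ hq'))
      have : Module.Projective R (LinearMap.ker r) := Module.Projective.of_split
        (e.symm.toLinearMap ∘ₗ LinearMap.inr R P _) (LinearMap.snd R P _ ∘ₗ e.toLinearMap)
        (by ext; simp)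
      have : Module.Projective R (LinearMap.ker r') := Module.Projective.of_split
        (e'.symm.toLinearMap ∘ₗ LinearMap.inr R P _) (LinearMap.snd R P _ ∘ₗ e'.toLinearMap)
        (by ext; simp)
      let _ : Module K P := Module.compHom P (algebraMap K R)
      have : IsScalarTower K R P := IsScalarTower.of_compHom K R P
      have : Module.Finite K P := Module.Finite.trans R P
      have : Module.Finite K Q := Module.Finite.trans R Q
      have : Nontrivial P := hπ.nontrivial
      have hlt : Module.finrank K (LinearMap.ker r) < n := by
        have h2 := (e.restrictScalars K).finrank_eq
        have h4 : Module.Finite K (LinearMap.ker r) := Module.Finite.trans R _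
        rw [Module.finrank_prod, hn] at h2
        have h3 : 0 < Module.finrank K P := Module.finrank_pos
        omega
      obtain ⟨e₁⟩ := ih _ hlt (LinearMap.ker r) (LinearMap.ker r') rfl (fun j => by
        have h2 := h j
        rw [finrank_hom_congr K (S j) e, finrank_hom_congr K (S j) e', finrank_hom_prod,
          finrank_hom_prod] at h2
        exact Nat.add_left_cancel h2)
      exact ⟨e.trans (((LinearEquiv.refl R P).prodCongr e₁).trans e'.symm)⟩

end Projective

/-! ### Families of homomorphisms between projective modules -/

/-- A homomorphism between finitely generated projective modules. -/
structure ProjectiveHom (R : Type u) [Ring R] where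
  P : Type u
  Q : Type u
  [addCommGroupP : AddCommGroup P]
  [addCommGroupQ : AddCommGroup Q]
  [moduleP : Module R P]
  [moduleQ : Module R Q]
  [finiteP : Module.Finite R P]
  [finiteQ : Module.Finite R Q]
  [projectiveP : Module.Projective R P]
  [projectiveQ : Module.Projective R Q]
  f : P →ₗ[R] Q

namespace ProjectiveHom

attribute [instance] addCommGroupP addCommGroupQ moduleP moduleQ finiteP finiteQ
  projectiveP projectiveQ

variable {R : Type u} [Ring R]

/-- The cokernel. -/
abbrev Coker (m : ProjectiveHom R) : Type u := m.Q ⧸ LinearMap.range m.f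

/-- Every homomorphism from the source of `m` to `X` extends along `m`. For injective `m`, this is
`Ext¹(Coker m, X) = 0`. -/
def Extends (m : ProjectiveHom R) (X : Type*) [AddCommGroup X] [Module R X] : Prop :=
  ∀ φ : m.P →ₗ[R] X, ∃ k : m.Q →ₗ[R] X, k ∘ₗ m.f = φ

/-- The coefficient of `Coker m` at the simple module `S` in the Grothendieck group of projective
modules. -/
noncomputable def mult (K : Type*) [Field K] [Algebra K R] (m : ProjectiveHom R) (S : Type*)
    [AddCommGroup S] [Module R S] [Module K S] [IsScalarTower K R S] : ℤ :=
  (Module.finrank K (m.Q →ₗ[R] S) : ℤ) - Module.finrank K (m.P →ₗ[R] S)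

theorem finrank_hom_pi (K : Type*) [Field K] [Algebra K R] [Module.Finite K R]
    {κ : Type*} [Fintype κ] (P : κ → Type*) (S : Type*) [∀ k, AddCommGroup (P k)]
    [AddCommGroup S] [∀ k, Module R (P k)] [Module R S] [Module K S] [IsScalarTower K R S]
    [∀ k, Module.Finite R (P k)] [Module.Finite R S] :
    Module.finrank K ((∀ k, P k) →ₗ[R] S) = ∑ k, Module.finrank K (P k →ₗ[R] S) := by
  classical
  have hfin : ∀ k, Module.Finite K (P k →ₗ[R] S) := fun k => by
    let _ : Module K (P k) := Module.compHom (P k) (algebraMap K R)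
    have : IsScalarTower K R (P k) := IsScalarTower.of_compHom K R (P k)
    have : Module.Finite K (P k) := Module.Finite.trans R (P k)
    have : Module.Finite K S := Module.Finite.trans R S
    exact finite_linearMap K R (P k) S
  rw [← Module.finrank_pi_fintype]
  exact (LinearMap.lsum R P K).finrank_eq.symm

theorem projective_pi {κ : Type*} [Finite κ] (P : κ → Type*) [∀ k, AddCommGroup (P k)]
    [∀ k, Module R (P k)] [∀ k, Module.Projective R (P k)] :
    Module.Projective R (∀ k, P k) := by
  classical
  have := Fintype.ofFinite κ
  exact Module.Projective.of_equiv' (DFinsupp.linearEquivFunOnFintype (R := R) (M := P))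

theorem mkQ_pi_exact {κ : Type*} (m : κ → ProjectiveHom R) :
    Function.Exact (LinearMap.pi fun k => (m k).f ∘ₗ LinearMap.proj k :
        (∀ k, (m k).P) →ₗ[R] ∀ k, (m k).Q)
      (LinearMap.pi fun k => (LinearMap.range (m k).f).mkQ ∘ₗ LinearMap.proj k :
        (∀ k, (m k).Q) →ₗ[R] ∀ k, (m k).Coker) := by
  intro q
  constructor
  · intro h
    have h1 : ∀ k, q k ∈ LinearMap.range (m k).f := fun k =>
      (Submodule.Quotient.mk_eq_zero _).1 (congrFun h k)
    choose p hp using h1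
    exact ⟨p, funext hp⟩
  · rintro ⟨p, rfl⟩
    funext k
    exact (Submodule.Quotient.mk_eq_zero _).2 ⟨p k, rfl⟩

theorem extends_pi {κ : Type*} [Fintype κ] (m : κ → ProjectiveHom R)
    (h : ∀ k l, (m k).Extends (m l).Coker) (φ : (∀ k, (m k).P) →ₗ[R] ∀ k, (m k).Coker) :
    ∃ g : (∀ k, (m k).Q) →ₗ[R] ∀ k, (m k).Coker,
      g ∘ₗ (LinearMap.pi fun k => (m k).f ∘ₗ LinearMap.proj k) = φ := by
  classical
  choose g hg using fun k l =>
    h k l (LinearMap.proj l ∘ₗ φ ∘ₗ LinearMap.single R (fun k => (m k).P) k)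
  refine ⟨LinearMap.pi fun l => ∑ k, g k l ∘ₗ LinearMap.proj k, ?_⟩
  refine LinearMap.pi_ext' fun k => LinearMap.ext fun x => funext fun l => ?_
  simp only [LinearMap.comp_apply, LinearMap.pi_apply, LinearMap.sum_apply, LinearMap.proj_apply,
    LinearMap.single_apply]
  rw [Finset.sum_eq_single k]
  · rw [Pi.single_eq_same]
    exact LinearMap.congr_fun (hg k l) x
  · intro j _ hj
    rw [Pi.single_eq_of_ne hj, _root_.map_zero, _root_.map_zero]
  · simp

/-- Two direct sums of mutually rigid cokernels with equal classes in the Grothendieck group of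
projective modules are isomorphic. -/
theorem nonempty_pi_coker_equiv (K : Type*) [Field K] [Infinite K] [Algebra K R] [Module.Finite K R]
    {ι : Type*} {S : ι → Type u} [∀ i, AddCommGroup (S i)]
    [∀ i, Module R (S i)] [∀ i, Module K (S i)] [∀ i, IsScalarTower K R (S i)]
    [∀ i, IsSimpleModule R (S i)]
    (hS : ∀ (M : Type u) [AddCommGroup M] [Module R M], IsSimpleModule R M →
      ∃ i, Nonempty (M ≃ₗ[R] S i))
    {κ κ' : Type u} [Fintype κ] [Fintype κ'] (m : κ → ProjectiveHom R) (m' : κ' → ProjectiveHom R)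
    (h : ∀ k l, (m k).Extends (m l).Coker) (h' : ∀ k l, (m' k).Extends (m' l).Coker)
    (heq : ∀ i, ∑ k, (m k).mult K (S i) = ∑ k, (m' k).mult K (S i)) :
    Nonempty ((∀ k, (m k).Coker) ≃ₗ[R] ∀ k, (m' k).Coker) := by
  -- Equality of the differences of multiplicities is rewritten, by moving sources across, as
  -- equality of tops of two honest projective modules.
  let Q := (∀ k, (m k).Q) × ∀ k, (m' k).P
  let _ : Module K Q := Module.compHom Q (algebraMap K R)
  have : IsScalarTower K R Q := IsScalarTower.of_compHom K R Q
  have := projective_pi (R := R) fun k => (m k).P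
  have := projective_pi (R := R) fun k => (m k).Q
  have := projective_pi (R := R) fun k => (m' k).P
  have := projective_pi (R := R) fun k => (m' k).Q
  obtain ⟨e⟩ := nonempty_equiv_of_finrank_hom_eq K hS _ Q ((∀ k, (m' k).Q) × ∀ k, (m k).P) rfl
    (fun i => by
      have h1 := heq i
      simp only [mult, Finset.sum_sub_distrib] at h1
      rw [finrank_hom_prod, finrank_hom_prod, finrank_hom_pi, finrank_hom_pi, finrank_hom_pi,
        finrank_hom_pi]
      zify
      linarith)
  refine nonempty_equiv_of_rigid K e ?_ (mkQ_pi_exact m) (extends_pi m h)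
    ?_ (mkQ_pi_exact m') (extends_pi m' h')
  · intro x
    choose q hq using fun k => (LinearMap.range (m k).f).mkQ_surjective (x k)
    exact ⟨q, funext hq⟩
  · intro x
    choose q hq using fun k => (LinearMap.range (m' k).f).mkQ_surjective (x k)
    exact ⟨q, funext hq⟩

end ProjectiveHom

/-! ### Injective modules and injective dimension -/

section Baer

variable {R : Type u} [Ring R]

theorem Module.Baer.of_retract {X Y : Type*} [AddCommGroup X] [AddCommGroup Y] [Module R X]
    [Module R Y] (i : X →ₗ[R] Y) (r : Y →ₗ[R] X) (hri : r ∘ₗ i = LinearMap.id)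
    (h : Module.Baer R Y) : Module.Baer R X := fun I g => by
  obtain ⟨g', hg'⟩ := h I (i ∘ₗ g)
  refine ⟨r ∘ₗ g', fun x hx => ?_⟩
  rw [LinearMap.comp_apply, hg' x hx]
  exact LinearMap.congr_fun hri _

theorem Module.Baer.pi {κ : Type*} {X : κ → Type*} [∀ k, AddCommGroup (X k)]
    [∀ k, Module R (X k)] (h : ∀ k, Module.Baer R (X k)) : Module.Baer R (∀ k, X k) := by
  intro I g
  choose g' hg' using fun k => h k I (LinearMap.proj k ∘ₗ g)
  exact ⟨LinearMap.pi g', fun x hx => funext fun k => hg' k x hx⟩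

theorem injectiveDimension_le_one_of_exact {M J₀ J₁ : Type u} [AddCommGroup M] [AddCommGroup J₀]
    [AddCommGroup J₁] [Module R M] [Module R J₀] [Module R J₁] (i : M →ₗ[R] J₀)
    (ρ : J₀ →ₗ[R] J₁) (hi : Function.Injective i) (hex : Function.Exact i ρ)
    (hρ : Function.Surjective ρ) (h₀ : Module.Baer R J₀) (h₁ : Module.Baer R J₁) :
    injectiveDimension (ModuleCat.of.{u} R M) ≤ 1 := by
  have := h₀.injective
  have := h₁.injective
  have : Injective (ModuleCat.of.{u} R J₀) := Module.injective_object_of_injective_module R J₀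
  have : Injective (ModuleCat.of.{u} R J₁) := Module.injective_object_of_injective_module R J₁
  let S : ShortComplex (ModuleCat.{u} R) := ShortComplex.mk (ModuleCat.ofHom i) (ModuleCat.ofHom ρ)
    (by ext x; exact hex.apply_apply_eq_zero x)
  have hS : S.ShortExact :=
    { exact := (ShortComplex.ShortExact.moduleCat_exact_iff_function_exact S).2 hex
      mono_f := (ModuleCat.mono_iff_injective _).2 hi
      epi_g := (ModuleCat.epi_iff_surjective _).2 hρ }
  have h := (hS.hasInjectiveDimensionLT_X₃_iff 0 inferInstance).1
    (inferInstanceAs (HasInjectiveDimensionLT (ModuleCat.of.{u} R J₁) 1))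
  exact (injectiveDimension_le_iff _ 1).2 h

end Baer

/-! ### Injective envelopes of simple modules in an injective cogenerator -/

section Envelope

variable {R : Type u} [Ring R]

/-- Every simple module embeds in `T`, so the isotypic components of `T` index the isomorphism
classes; they are finite in number because `T` is noetherian. -/
theorem exists_simple_representatives (T : Type u) [AddCommGroup T] [Module R T]
    [IsNoetherian R T]
    (hT : ∀ (M : Type u) [AddCommGroup M] [Module R M], IsSimpleModule R M →
      ∃ φ : M →ₗ[R] T, φ ≠ 0) :
    ∃ (ι : Type u) (_ : Finite ι) (S : ι → Submodule R T), (∀ i, IsSimpleModule R (S i)) ∧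
      (∀ (M : Type u) [AddCommGroup M] [Module R M], IsSimpleModule R M →
        ∃ i, Nonempty (M ≃ₗ[R] S i)) ∧ ∀ i j, Nonempty (S i ≃ₗ[R] S j) → i = j := by
  choose S hS hc using fun c : isotypicComponents R T => c.2
  refine ⟨isotypicComponents R T, inferInstance, S, hS, ?_, ?_⟩
  · intro M _ _ hM
    obtain ⟨φ, hφ⟩ := hT M hM
    have hinj := LinearMap.injective_of_ne_zero hφ
    let e := LinearEquiv.ofInjective φ hinj
    have hr : IsSimpleModule R (LinearMap.range φ) := IsSimpleModule.congr e.symm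
    let c : isotypicComponents R T := ⟨isotypicComponent R T (LinearMap.range φ), _, hr, rfl⟩
    refine ⟨c, ?_⟩
    have h1 : LinearMap.range φ ≤ isotypicComponent R T (S c) := by
      have : (c : Submodule R T) = _ := hc c
      rw [← this]
      exact Submodule.le_isotypicComponent _
    have := hS c
    obtain ⟨e'⟩ := isIsotypicOfType_submodule_iff.1
      (IsIsotypicOfType.isotypicComponent R T (S c)) _ h1
    exact ⟨e.trans e'⟩
  · rintro c c' ⟨e⟩
    apply Subtype.ext
    rw [hc c, hc c']
    exact e.isotypicComponent_eq

/-- In an injective module of finite length, every simple submodule lies, up to isomorphism, in a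
direct summand whose simple submodules are all isomorphic to it. -/
theorem exists_retract_of_simple (T : Type u) [AddCommGroup T] [Module R T]
    [IsNoetherian R T] [IsArtinian R T] (hT : Module.Baer R T) (S : Submodule R T)
    [IsSimpleModule R S] :
    ∃ (I : Submodule R T) (r : T →ₗ[R] I), r ∘ₗ I.subtype = LinearMap.id ∧
      (∃ j : S →ₗ[R] I, j ≠ 0) ∧
      ∀ (M : Type u) [AddCommGroup M] [Module R M], IsSimpleModule R M →
        ∀ φ : M →ₗ[R] I, φ ≠ 0 → Nonempty (M ≃ₗ[R] S) := by
  -- A minimal summand containing a copy of `S` is taken, in place of an injective envelope.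
  let C : Set (Submodule R T) :=
    {I | (∃ r : T →ₗ[R] I, r ∘ₗ I.subtype = LinearMap.id) ∧
      ∃ j : S →ₗ[R] I, Function.Injective j}
  have hC : C.Nonempty := ⟨⊤, ⟨LinearMap.id.codRestrict ⊤ fun _ => trivial, rfl⟩,
    S.subtype.codRestrict ⊤ (fun _ => trivial), fun x y h => by
      have h' := congrArg Subtype.val h
      exact Subtype.ext h'⟩
  obtain ⟨I, ⟨⟨r, hr⟩, j, hj⟩, hmin⟩ := WellFounded.has_min (wellFounded_lt
    (α := Submodule R T)) C hC
  have hnt := IsSimpleModule.nontrivial R S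
  refine ⟨I, r, hr, ⟨j, ?_⟩, ?_⟩
  · rintro rfl
    obtain ⟨x, hx⟩ := exists_ne (0 : S)
    exact hx (hj rfl)
  intro M _ _ hM φ hφ
  by_contra hiso
  have hφi := LinearMap.injective_of_ne_zero hφ
  let e := LinearEquiv.ofInjective φ hφi
  let e' := LinearEquiv.ofInjective j hj
  have a1 : IsAtom (LinearMap.range φ) := isSimpleModule_iff_isAtom.1 (IsSimpleModule.congr e.symm)
  have a2 : IsAtom (LinearMap.range j) := isSimpleModule_iff_isAtom.1 (IsSimpleModule.congr e'.symm)
  have hdisj : Disjoint (LinearMap.range j) (LinearMap.range φ) := by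
    refine a2.disjoint_of_ne a1 fun h => hiso ?_
    exact ⟨e.trans ((LinearEquiv.ofEq _ _ h.symm).trans e'.symm)⟩
  have hinj : Function.Injective (j.coprod φ) := by
    rw [← LinearMap.ker_eq_bot, LinearMap.ker_coprod_of_disjoint_range _ _ hdisj,
      LinearMap.ker_eq_bot.2 hj, LinearMap.ker_eq_bot.2 hφi, Submodule.prod_bot]
  have hI : Module.Baer R I := hT.of_retract I.subtype r hr
  -- If a simple `M` not isomorphic to `S` embedded in `I`, then `S × M` would embed too, and
  -- injectivity gives `θ` killing `S` and fixing `M`. By Fitting's lemma the kernel of a power of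
  -- `θ` is a summand containing `S` but not `M`, against minimality.
  obtain ⟨θ, hθ⟩ := hI.extension_property (j.coprod φ) hinj (φ ∘ₗ LinearMap.snd R S M)
  have hθj : ∀ s, θ (j s) = 0 := fun s => by simpa using LinearMap.congr_fun hθ (s, 0)
  have hθφ : ∀ m, θ (φ m) = φ m := fun m => by simpa using LinearMap.congr_fun hθ (0, m)
  obtain ⟨k, hk1, hk⟩ := ((Filter.eventually_ge_atTop 1).and
    (LinearMap.eventually_isCompl_ker_pow_range_pow θ)).exists
  obtain ⟨n, rfl⟩ : ∃ n, k = n + 1 := ⟨k - 1, by omega⟩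
  have hθφn : ∀ (n : ℕ) m, (θ ^ n) (φ m) = φ m := by
    intro n m
    induction n with
    | zero => simp
    | succ n ih => rw [pow_succ, Module.End.mul_apply, hθφ, ih]
  let N := LinearMap.ker (θ ^ (n + 1))
  let en := Submodule.equivMapOfInjective I.subtype I.injective_subtype N
  have hN : N.map I.subtype ∈ C := by
    refine ⟨⟨en.toLinearMap ∘ₗ Submodule.projectionOnto _ _ hk ∘ₗ r, ?_⟩,
      en.toLinearMap ∘ₗ j.codRestrict N (fun s => ?_), ?_⟩
    · ext ⟨x, y, hy, rfl⟩
      have h1 : r (I.subtype y) = y := LinearMap.congr_fun hr y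
      have h2 : Submodule.projectionOnto _ _ hk y = ⟨y, hy⟩ :=
        Submodule.projectionOnto_apply_left hk ⟨y, hy⟩
      simp only [LinearMap.comp_apply, Submodule.subtype_apply] at h1 ⊢
      rw [h1, h2]
      rfl
    · rw [LinearMap.mem_ker, pow_succ, Module.End.mul_apply, hθj, _root_.map_zero]
    · exact en.injective.comp fun x y h => hj (congrArg Subtype.val h)
  have heq : N.map I.subtype = I :=
    eq_of_le_of_not_lt (Submodule.map_subtype_le _ _) (hmin _ hN)
  apply hφ
  ext m
  have hm : ((φ m : I) : T) ∈ N.map I.subtype := heq.symm ▸ (φ m).2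
  obtain ⟨y, hy, hym⟩ := hm
  have hym' : y = φ m := Subtype.ext hym
  subst hym'
  have := hθφn (n + 1) m
  rw [LinearMap.mem_ker.1 hy] at this
  rw [← this]
  rfl

end Envelope

/-! ### Direct summands and the universal extension in projective dimension at most one -/

namespace ProjectiveHom

variable {R : Type u} [Ring R]

theorem extends_of_baer (m : ProjectiveHom R) (hm : Function.Injective m.f) {X : Type*}
    [AddCommGroup X] [Module R X] (hX : Module.Baer R X) : m.Extends X := fun φ => by
  obtain ⟨k, hk⟩ := hX.extension_property m.f hm φ
  exact ⟨k, hk⟩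

/-- A direct summand of a module of projective dimension at most one has projective dimension at
most one. -/
theorem exists_of_retract [IsNoetherianRing R] (d : ProjectiveHom R) (hd : Function.Injective d.f)
    (I : Submodule R d.Coker) (r : d.Coker →ₗ[R] I) (hr : r ∘ₗ I.subtype = LinearMap.id) :
    ∃ m : ProjectiveHom R, Function.Injective m.f ∧ Nonempty (m.Coker ≃ₗ[R] I) ∧
      ∀ (X : Type u) [AddCommGroup X] [Module R X], d.Extends X → m.Extends X := by
  let p := (LinearMap.range d.f).mkQ
  have hp : ∀ x, p x = 0 ↔ x ∈ LinearMap.range d.f := fun x => Submodule.Quotient.mk_eq_zero _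
  have hrI : ∀ y : I, r y = y := fun y => LinearMap.congr_fun hr y
  let N := LinearMap.ker (r ∘ₗ p)
  -- `ε` lifts to `d.Q` the idempotent of the cokernel with image `I`; it need not be idempotent
  -- itself.
  obtain ⟨ε, hε⟩ := Module.projective_lifting_property p (I.subtype ∘ₗ r ∘ₗ p)
    (Submodule.mkQ_surjective _)
  have hε' : ∀ x, p (ε x) = r (p x) := fun x => LinearMap.congr_fun hε x
  have hεN : ∀ x : N, ε x ∈ LinearMap.range d.f := fun x => by
    rw [← hp, hε', show r (p x) = 0 from x.2]
    rfl
  let c : d.Q →ₗ[R] N := (LinearMap.id - ε).codRestrict N fun x => by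
    rw [LinearMap.mem_ker, LinearMap.comp_apply, LinearMap.sub_apply, LinearMap.id_apply,
      _root_.map_sub, _root_.map_sub, hε', hrI, sub_self]
  have hle : LinearMap.range d.f ≤ N := fun x hx => by
    rw [LinearMap.mem_ker, LinearMap.comp_apply, (hp x).2 hx, _root_.map_zero]
  have : Module.Projective R (LinearMap.range d.f) :=
    Module.Projective.of_equiv' (LinearEquiv.ofInjective d.f hd)
  -- On `N` the decomposition `x = ε x + (x - ε x)` exhibits `N` as a summand of `LinearMap.range
  -- d.f × d.Q`.
  have : Module.Projective R N := Module.Projective.of_split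
    (((ε ∘ₗ N.subtype).codRestrict (LinearMap.range d.f) hεN).prod N.subtype)
    ((Submodule.inclusion hle).coprod c) (LinearMap.ext fun x => Subtype.ext (add_sub_cancel (ε x) (x : d.Q)))
  refine ⟨{ P := N, Q := d.Q, f := N.subtype }, N.injective_subtype, ⟨?_⟩, ?_⟩
  · refine (Submodule.quotEquivOfEq _ _ (Submodule.range_subtype N)).trans
      ((r ∘ₗ p).quotKerEquivOfSurjective ?_)
    intro y
    obtain ⟨x, hx⟩ := Submodule.mkQ_surjective _ (y : d.Coker)
    exact ⟨x, by rw [LinearMap.comp_apply, hx, hrI]⟩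
  · intro X _ _ hX φ
    let f' : d.P →ₗ[R] N := d.f.codRestrict N fun x => hle ⟨x, rfl⟩
    obtain ⟨k, hk⟩ := hX (φ ∘ₗ f')
    -- The map `k` agrees with `φ` only on the image of `d.f`. For `x` in `N`, `x - c x` lies in
    -- that image, so composing the error with `c` corrects it exactly.
    refine ⟨k + (φ - k ∘ₗ N.subtype) ∘ₗ c, LinearMap.ext fun x => ?_⟩
    obtain ⟨y, hy⟩ := hεN x
    have hc : c x = x - f' y := Subtype.ext (by simp [c, f', hy])
    have hky : k (d.f y) = φ (f' y) := LinearMap.congr_fun hk y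
    simp only [LinearMap.comp_apply, LinearMap.add_apply, LinearMap.sub_apply,
      Submodule.subtype_apply, hc, _root_.map_sub]
    rw [show ((f' y : N) : d.Q) = d.f y from rfl, hky]
    abel

/-- The universal extension of `Coker d` by the regular module. -/
theorem exists_universal_extension (K : Type*) [Field K] [Algebra K R] [Module.Finite K R]
    (d : ProjectiveHom R) (hd : Function.Injective d.f) (hT : Module.Baer R d.Coker) :
    ∃ m : ProjectiveHom R, Function.Injective m.f ∧ m.Extends m.Coker ∧ d.Extends m.Coker ∧
      ∃ (n : ℕ) (i : R →ₗ[R] m.Coker) (ρ : m.Coker →ₗ[R] (Fin n → d.Coker)),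
        Function.Injective i ∧ Function.Exact i ρ ∧ Function.Surjective ρ := by
  let _ : Module K d.P := Module.compHom d.P (algebraMap K R)
  let _ : Module K d.Q := Module.compHom d.Q (algebraMap K R)
  have : IsScalarTower K R d.P := IsScalarTower.of_compHom K R d.P
  have : IsScalarTower K R d.Q := IsScalarTower.of_compHom K R d.Q
  have : Module.Finite K d.P := Module.Finite.trans R d.P
  have := finite_linearMap K R d.P R
  obtain ⟨n, h, hspan⟩ := Module.Finite.exists_fin (R := K) (M := d.P →ₗ[R] R)
  let p := (LinearMap.range d.f).mkQ
  let fn : (Fin n → d.P) →ₗ[R] (Fin n → d.Q) := LinearMap.pi fun k => d.f ∘ₗ LinearMap.proj k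
  let hn : (Fin n → d.P) →ₗ[R] R := ∑ k, h k ∘ₗ LinearMap.proj k
  have hn_apply : ∀ x, hn x = ∑ k, h k (x k) := fun x => by simp [hn]
  have hfn : Function.Injective fn := fun x y hxy => funext fun k => hd (congrFun hxy k)
  have := projective_pi (R := R) fun _ : Fin n => d.P
  have := projective_pi (R := R) fun _ : Fin n => d.Q
  -- The cokernel is the pushout of `n` copies of the resolution along `(h₁, …, hₙ)`, where the `hₖ`
  -- span `Hom(d.P, R)` and hence all classes in `Ext¹(Coker d, R)`.
  let m : ProjectiveHom R := { P := Fin n → d.P, Q := R × (Fin n → d.Q), f := hn.prod fn }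
  let q : m.Q →ₗ[R] m.Coker := (LinearMap.range m.f).mkQ
  have hqm : ∀ x, q (m.f x) = 0 := fun x => (Submodule.Quotient.mk_eq_zero _).2 ⟨x, rfl⟩
  have hdE : d.Extends m.Coker := by
    intro φ
    obtain ⟨ψ, hψ⟩ := Module.projective_lifting_property q φ (Submodule.mkQ_surjective _)
    let α : d.P →ₗ[R] R := LinearMap.fst R _ _ ∘ₗ ψ
    let β : Fin n → d.P →ₗ[R] d.Q := fun k => LinearMap.proj k ∘ₗ LinearMap.snd R _ _ ∘ₗ ψ
    -- This is `Ext¹(T, T) = 0` for the injective module `T = Coker d`, written at the level of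
    -- presentations.
    have hstep : ∀ k, ∃ (c : d.Q →ₗ[R] d.Q) (γ : d.P →ₗ[R] d.P), ∀ x,
        β k x = c (d.f x) + d.f (γ x) := by
      intro k
      obtain ⟨c', hc'⟩ := d.extends_of_baer hd hT (p ∘ₗ β k)
      obtain ⟨c, hc⟩ := Module.projective_lifting_property p c' (Submodule.mkQ_surjective _)
      obtain ⟨γ, hγ⟩ := exists_lift_of_exact (f := d.f) (π := p) (fun x => by
        rw [Submodule.mkQ_apply, Submodule.Quotient.mk_eq_zero]; rfl) (β k - c ∘ₗ d.f)
        (LinearMap.ext fun x => by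
          have h1 : c' (d.f x) = p (β k x) := LinearMap.congr_fun hc' x
          have h2 : p (c (d.f x)) = c' (d.f x) := LinearMap.congr_fun hc (d.f x)
          change p (β k x - c (d.f x)) = 0
          rw [_root_.map_sub, h2, h1, sub_self])
      refine ⟨c, γ, fun x => ?_⟩
      have h1 : d.f (γ x) = β k x - c (d.f x) := LinearMap.congr_fun hγ x
      rw [h1]
      exact (add_sub_cancel _ _).symm
    choose c γ hcγ using hstep
    -- Universality enters here: the remaining component into `R` is a `K`-combination of the `hₖ`,
    -- so it is absorbed by the image of `m.f`, at the cost of a term factoring through `d.f`.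
    have hα : α - ∑ k, h k ∘ₗ γ k ∈ Submodule.span K (Set.range h) := hspan ▸ Submodule.mem_top
    obtain ⟨l, hl⟩ := (Submodule.mem_span_range_iff_exists_fun K).1 hα
    have hαx : ∀ x, α x = ∑ k, h k (γ k x + l k • x) := by
      intro x
      have := LinearMap.congr_fun hl x
      simp only [LinearMap.sum_apply, LinearMap.sub_apply, LinearMap.smul_apply,
        LinearMap.comp_apply] at this
      simp only [_root_.map_add, LinearMap.map_smul_of_tower, Finset.sum_add_distrib, this]
      abel
    let κ : d.Q →ₗ[R] m.Q := LinearMap.inr R R (Fin n → d.Q) ∘ₗ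
      LinearMap.pi fun k => c k - l k • LinearMap.id
    refine ⟨q ∘ₗ κ, LinearMap.ext fun x => ?_⟩
    have hx : ψ x = m.f (fun k => γ k x + l k • x) + κ (d.f x) := by
      apply Prod.ext
      · change α x = hn _ + 0
        rw [hαx, hn_apply, add_zero]
      · funext k
        change β k x = d.f (γ k x + l k • x) + (c k (d.f x) - l k • d.f x)
        rw [hcγ, _root_.map_add, LinearMap.map_smul_of_tower]
        abel
    have h1 : q (ψ x) = φ x := LinearMap.congr_fun hψ x
    rw [← h1, hx, _root_.map_add, hqm, zero_add]
    rfl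
  refine ⟨m, ?_, ?_, hdE, n, q ∘ₗ LinearMap.inl R R (Fin n → d.Q),
    (LinearMap.range m.f).liftQ ((LinearMap.pi fun k => p ∘ₗ LinearMap.proj k) ∘ₗ
      LinearMap.snd R R (Fin n → d.Q)) ?_, ?_, ?_, ?_⟩
  · exact fun x y hxy => hfn (congrArg Prod.snd hxy)
  · intro φ
    choose k hk using fun i => hdE (φ ∘ₗ LinearMap.single R (fun _ : Fin n => d.P) i)
    refine ⟨(∑ i, k i ∘ₗ LinearMap.proj i) ∘ₗ LinearMap.snd R R (Fin n → d.Q), ?_⟩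
    refine LinearMap.pi_ext' fun i => LinearMap.ext fun x => ?_
    rw [← hk i]
    change (∑ j, k j ∘ₗ LinearMap.proj j) (fn (Pi.single i x)) = k i (d.f x)
    simp only [LinearMap.sum_apply, LinearMap.comp_apply, LinearMap.proj_apply]
    rw [Finset.sum_eq_single i]
    · simp [fn]
    · intro j _ hj
      simp [fn, Pi.single_eq_of_ne hj]
    · simp
  · rintro _ ⟨x, rfl⟩
    rw [LinearMap.mem_ker]
    funext k
    exact (Submodule.Quotient.mk_eq_zero _).2 ⟨x k, rfl⟩
  · rw [← LinearMap.ker_eq_bot, LinearMap.ker_eq_bot']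
    intro a ha
    obtain ⟨x, hx⟩ := (Submodule.Quotient.mk_eq_zero _).1 ha
    have h0 : x = 0 := hfn ((congrArg Prod.snd hx).trans (_root_.map_zero fn).symm)
    subst h0
    exact (congrArg Prod.fst hx).symm.trans (_root_.map_zero hn)
  · intro y
    obtain ⟨⟨a, z⟩, rfl⟩ := Submodule.mkQ_surjective _ y
    constructor
    · intro hy
      have h1 : ∀ k, z k ∈ LinearMap.range d.f := fun k =>
        (Submodule.Quotient.mk_eq_zero _).1 (congrFun hy k)
      choose x hx using h1
      refine ⟨a - hn x, ?_⟩
      have h2 : ((a, z) : m.Q) = m.f x + (a - hn x, 0) := by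
        apply Prod.ext
        · change a = hn x + (a - hn x)
          abel
        · funext k
          change z k = d.f (x k) + 0
          rw [hx, add_zero]
      change q (a - hn x, 0) = q (a, z)
      rw [h2, _root_.map_add, hqm, zero_add]
    · rintro ⟨b, hb⟩
      rw [← hb]
      funext k
      exact _root_.map_zero p
  · intro y
    choose z hz using fun k => (LinearMap.range d.f).mkQ_surjective (y k)
    exact ⟨q (0, z), funext hz⟩

end ProjectiveHom

/-! ### Relations in the Grothendieck group and injectivity of the universal extension -/

namespace ProjectiveHom

variable {R : Type u} [Ring R]

/-- An integral relation between the classes of mutually rigid modules in the Grothendieck group of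
projective modules gives an isomorphism of direct sums. -/
theorem nonempty_equiv_of_relation (K : Type*) [Field K] [Infinite K] [Algebra K R]
    [Module.Finite K R] {ι : Type*} {S : ι → Type u} [∀ i, AddCommGroup (S i)]
    [∀ i, Module R (S i)] [∀ i, Module K (S i)] [∀ i, IsScalarTower K R (S i)]
    [∀ i, IsSimpleModule R (S i)]
    (hS : ∀ (M : Type u) [AddCommGroup M] [Module R M], IsSimpleModule R M →
      ∃ i, Nonempty (M ≃ₗ[R] S i))
    {κ : Type u} [Fintype κ] (m : κ → ProjectiveHom R)
    (h : ∀ k l, (m k).Extends (m l).Coker) (c : κ → ℤ)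
    (hc : ∀ i, ∑ k, c k * (m k).mult K (S i) = 0) :
    Nonempty ((∀ x : (Σ k, Fin (c k).toNat), (m x.1).Coker) ≃ₗ[R]
      ∀ x : (Σ k, Fin (-c k).toNat), (m x.1).Coker) := by
  refine nonempty_pi_coker_equiv K hS (fun x : (Σ k, Fin (c k).toNat) => m x.1)
    (fun x : (Σ k, Fin (-c k).toNat) => m x.1) (fun k l => h _ _) (fun k l => h _ _) fun i => ?_
  rw [← sub_eq_zero, Fintype.sum_sigma, Fintype.sum_sigma, ← Finset.sum_sub_distrib, ← hc i]
  refine Finset.sum_congr rfl fun k _ => ?_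
  simp only [Finset.sum_const, Finset.card_univ, Fintype.card_fin, nsmul_eq_mul]
  rw [← sub_mul, Int.toNat_sub_toNat_neg]

/-- If an injective cogenerator has projective dimension at most one, then the regular module has
injective dimension at most one. -/
theorem injectiveDimension_self_le_one (K : Type*) [Field K] [Infinite K] [Algebra K R]
    [Module.Finite K R] (d : ProjectiveHom R) (hd : Function.Injective d.f)
    (hT : Module.Baer R d.Coker)
    (hsimple : ∀ (M : Type u) [AddCommGroup M] [Module R M], IsSimpleModule R M →
      ∃ φ : M →ₗ[R] d.Coker, φ ≠ 0) :
    injectiveDimension (ModuleCat.of.{u} R R) ≤ 1 := by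
  classical
  have : IsArtinianRing R := IsArtinianRing.of_finite K R
  let _ : Module K d.Coker := Module.compHom d.Coker (algebraMap K R)
  have : IsScalarTower K R d.Coker := IsScalarTower.of_compHom K R d.Coker
  obtain ⟨ι, _, S, hSs, hS, hSinj⟩ := exists_simple_representatives d.Coker hsimple
  have := Fintype.ofFinite ι
  choose I r hr hIne hI using fun i => exists_retract_of_simple d.Coker hT (S i)
  choose m hm e hme using fun i => d.exists_of_retract hd (I i) (r i) (hr i)
  obtain ⟨E, hE, hEE, hdE, n, i₀, ρ, hi₀, hex, hρ⟩ := d.exists_universal_extension K hd hT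
  have hmB : ∀ i, Module.Baer R (m i).Coker := fun i =>
    (hT.of_retract (I i).subtype (r i) (hr i)).of_equiv (e i).some.symm
  let v : Option ι → ProjectiveHom R := fun o => o.elim E m
  have hv : ∀ k l, (v k).Extends (v l).Coker := by
    rintro (_ | k) (_ | l)
    · exact hEE
    · exact E.extends_of_baer hE (hmB l)
    · exact hme k _ hdE
    · exact (m k).extends_of_baer (hm k) (hmB l)
  -- There are `|ι| + 1` classes in the free group `ℤ^ι`; the index `none` stands for `E`.
  obtain ⟨c, hc, o, ho⟩ : ∃ c : Option ι → ℤ,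
      (∀ i, ∑ k, c k * (v k).mult K (S i) = 0) ∧ ∃ o, c o ≠ 0 := by
    have hli : ¬ LinearIndependent ℤ (fun o i => (v o).mult K (S i) : Option ι → ι → ℤ) := by
      intro h
      have := h.fintype_card_le_finrank
      rw [Module.finrank_fintype_fun_eq_card, Fintype.card_option] at this
      omega
    obtain ⟨c, hc, ho⟩ := Fintype.not_linearIndependent_iff.1 hli
    exact ⟨c, fun i => by simpa using congrFun hc i, ho⟩
  have hneg : ∀ c : Option ι → ℤ, (∀ i, ∑ k, c k * (v k).mult K (S i) = 0) →
      ∀ i, ∑ k, (-c k) * (v k).mult K (S i) = 0 := fun c hc i => by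
    simp only [neg_mul, Finset.sum_neg_distrib, hc i, neg_zero]
  -- With positive coefficient, `E` occurs on the left of the isomorphism and not on the right,
  -- where all summands are injective.
  have hpos : ∀ c : Option ι → ℤ, (∀ i, ∑ k, c k * (v k).mult K (S i) = 0) →
      0 < c none → Module.Baer R E.Coker := by
    intro c hc h0
    obtain ⟨θ⟩ := nonempty_equiv_of_relation K hS v hv c hc
    let x₀ : Σ k, Fin (c k).toNat := ⟨none, ⟨0, by omega⟩⟩
    have hB : Module.Baer R (∀ x : (Σ k, Fin (-c k).toNat), (v x.1).Coker) := by
      refine Module.Baer.pi ?_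
      rintro ⟨_ | k, x⟩
      · exact absurd x.2 (by omega)
      · exact hmB k
    refine (hB.of_equiv θ.symm).of_retract
      (LinearMap.single R (fun x : (Σ k, Fin (c k).toNat) => (v x.1).Coker) x₀)
      (LinearMap.proj x₀) ?_
    exact LinearMap.proj_comp_single_same R _ x₀
  have hzero : ∀ c : Option ι → ℤ, (∀ i, ∑ k, c k * (v k).mult K (S i) = 0) →
      c none = 0 → ∀ i, ¬ 0 < c (some i) := by
    intro c hc h0 i hi
    obtain ⟨θ⟩ := nonempty_equiv_of_relation K hS v hv c hc
    let x₀ : Σ k, Fin (c k).toNat := ⟨some i, ⟨0, by omega⟩⟩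
    obtain ⟨j, hj⟩ := hIne i
    let ψ : S i →ₗ[R] (∀ x : (Σ k, Fin (-c k).toNat), (v x.1).Coker) :=
      θ.toLinearMap ∘ₗ LinearMap.single R (fun x : (Σ k, Fin (c k).toNat) => (v x.1).Coker) x₀ ∘ₗ
        (e i).some.symm.toLinearMap ∘ₗ j
    -- A nonzero component of `ψ` in a summand of type `k` forces `S k ≃ S i`, so `k = i`. But type
    -- `i` is absent on the right since its coefficient is positive.
    have hψ : ψ = 0 := by
      by_contra hψ
      obtain ⟨s, hs⟩ : ∃ s, ψ s ≠ 0 := by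
        by_contra! h
        exact hψ (LinearMap.ext h)
      obtain ⟨⟨k, x⟩, hk⟩ := Function.ne_iff.1 hs
      rcases k with _ | k
      · exact absurd x.2 (by omega)
      · have hne : (e k).some.toLinearMap ∘ₗ LinearMap.proj (⟨some k, x⟩ : Σ k, Fin (-c k).toNat) ∘ₗ
            ψ ≠ 0 := fun h => by
          refine hk ((e k).some.injective ?_)
          exact (LinearMap.congr_fun h s).trans (_root_.map_zero _).symm
        have hik := hSinj i k (hI k _ (hSs i) _ hne)
        subst hik
        exact absurd x.2 (by omega)
    apply hj
    ext s
    have h1 := LinearMap.congr_fun hψ s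
    have h2 := θ.injective (h1.trans (_root_.map_zero θ).symm)
    have h3 := congrFun h2 x₀
    have h4 : (e i).some.symm (j s) = 0 :=
      (Pi.single_eq_same (M := fun x : (Σ k, Fin (c k).toNat) => (v x.1).Coker) x₀
        ((e i).some.symm (j s))).symm.trans h3
    rw [(e i).some.symm.injective (h4.trans (_root_.map_zero _).symm)]
    rfl
  have hEB : Module.Baer R E.Coker := by
    rcases lt_trichotomy 0 (c none) with h0 | h0 | h0
    · exact hpos c hc h0
    · rcases o with _ | i
      · exact absurd h0.symm ho
      · rcases lt_or_gt_of_ne ho with h | h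
        · exact absurd (show 0 < -c (some i) by omega)
            (hzero (fun k => -c k) (hneg c hc) (by omega) i)
        · exact absurd h (hzero c hc h0.symm i)
    · exact hpos (fun k => -c k) (hneg c hc) (by omega)
  exact injectiveDimension_le_one_of_exact i₀ ρ hi₀ hex hρ hEB (Module.Baer.pi fun _ => hT)

end ProjectiveHom

/-! ### Duality between modules over anti-isomorphic algebras -/

/-- The standard dual of an `R`-module as a module over `S`, for an anti-isomorphism `σ`. -/
def DualVia (K : Type w) [Field K] {R S : Type u} [Ring R] [Ring S] [Algebra K R]
    (_σ : S ≃+* Rᵐᵒᵖ) (M : Type*) [AddCommGroup M] [Module R M] : Type _ :=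
  StdDual K R M

namespace DualVia

variable {K : Type w} [Field K] {R S : Type u} [Ring R] [Ring S] [Algebra K R]
  {σ : S ≃+* Rᵐᵒᵖ}

section

variable {M : Type*} [AddCommGroup M] [Module R M]

instance : AddCommGroup (DualVia K σ M) := inferInstanceAs (AddCommGroup (StdDual K R M))

instance : FunLike (DualVia K σ M) M K := inferInstanceAs (FunLike (StdDual K R M) M K)

instance : AddMonoidHomClass (DualVia K σ M) M K where
  map_add := StdDual.map_add
  map_zero := StdDual.map_zero

instance : Module S (DualVia K σ M) := Module.compHom (StdDual K R M) σ.toRingHom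

theorem smul_apply (s : S) (φ : DualVia K σ M) (m : M) : (s • φ) m = φ ((σ s).unop • m) := rfl

theorem add_apply (φ ψ : DualVia K σ M) (m : M) : (φ + ψ) m = φ m + ψ m := rfl

theorem zero_apply (m : M) : (0 : DualVia K σ M) m = 0 := rfl

theorem map_algebraMap_smul (φ : DualVia K σ M) (c : K) (m : M) :
    φ (algebraMap K R c • m) = c * φ m := StdDual.map_smul φ c m

instance [Module.Finite K R] [Module.Finite R M] : Module.Finite S (DualVia K σ M) := by
  obtain ⟨s, hs⟩ := (inferInstance : Module.Finite Rᵐᵒᵖ (StdDual K R M))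
  let s' : Finset (DualVia K σ M) := s
  have key : ∀ x : StdDual K R M, x ∈ Submodule.span Rᵐᵒᵖ (s : Set (StdDual K R M)) →
      (show DualVia K σ M from x) ∈ Submodule.span S (s' : Set (DualVia K σ M)) := by
    intro x hx
    induction hx using Submodule.span_induction with
    | mem x hx => exact Submodule.subset_span hx
    | zero => exact Submodule.zero_mem _
    | add x y _ _ hx hy => exact Submodule.add_mem _ hx hy
    | smul r x _ hx =>
      have h : (show DualVia K σ M from r • x) = σ.symm r • (show DualVia K σ M from x) :=
        DFunLike.ext _ _ fun m => by
          change x (r.unop • m) = x ((σ (σ.symm r)).unop • m)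
          rw [RingEquiv.apply_symm_apply]
      rw [h]
      exact Submodule.smul_mem _ (σ.symm r) hx
  exact ⟨s', eq_top_iff.2 fun φ _ => key φ (hs ▸ Submodule.mem_top)⟩

/-- A functional which is linear for the scalar action through `R`. -/
theorem exists_of_linearMap [Module K M] [IsScalarTower K R M] (l : M →ₗ[K] K) :
    ∃ φ : DualVia K σ M, ∀ m, φ m = l m :=
  ⟨⟨l.toAddMonoidHom, fun c m => by
    change l (algebraMap K R c • m) = c * l m
    rw [algebraMap_smul, _root_.map_smul, smul_eq_mul]⟩, fun _ => rfl⟩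

/-- The underlying functional. -/
def toLinearMap [Module K M] [IsScalarTower K R M] (φ : DualVia K σ M) : M →ₗ[K] K where
  toFun := φ
  map_add' := _root_.map_add φ
  map_smul' c m := by
    rw [← algebraMap_smul R c m, map_algebraMap_smul]
    rfl

theorem toLinearMap_apply [Module K M] [IsScalarTower K R M] (φ : DualVia K σ M) (m : M) :
    φ.toLinearMap m = φ m := rfl

theorem exists_extension {N : Type*} [AddCommGroup N] [Module R N] (j : M →ₗ[R] N)
    (hj : Function.Injective j) (φ : DualVia K σ M) :
    ∃ ψ : DualVia K σ N, ∀ m, ψ (j m) = φ m := by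
  let _ : Module K M := Module.compHom M (algebraMap K R)
  let _ : Module K N := Module.compHom N (algebraMap K R)
  have : IsScalarTower K R M := IsScalarTower.of_compHom K R M
  have : IsScalarTower K R N := IsScalarTower.of_compHom K R N
  obtain ⟨r, hr⟩ := (j.restrictScalars K).exists_leftInverse_of_injective
    (LinearMap.ker_eq_bot.2 hj)
  obtain ⟨ψ, hψ⟩ := exists_of_linearMap (σ := σ) (φ.toLinearMap ∘ₗ r)
  refine ⟨ψ, fun m => ?_⟩
  have h : r (j m) = m := LinearMap.congr_fun hr m
  rw [hψ, LinearMap.comp_apply, h, toLinearMap_apply]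

theorem exists_apply_ne_zero (m : M) (hm : m ≠ 0) : ∃ φ : DualVia K σ M, φ m ≠ 0 := by
  let _ : Module K M := Module.compHom M (algebraMap K R)
  have : IsScalarTower K R M := IsScalarTower.of_compHom K R M
  obtain ⟨l, hl⟩ : ∃ l : M →ₗ[K] K, l m ≠ 0 := by
    by_contra! h
    exact hm ((Module.forall_dual_apply_eq_zero_iff K m).1 h)
  obtain ⟨φ, hφ⟩ := exists_of_linearMap (σ := σ) l
  exact ⟨φ, by rwa [hφ]⟩

/-- The dual of a homomorphism. -/
def map (σ : S ≃+* Rᵐᵒᵖ) {N : Type*} [AddCommGroup N] [Module R N] (j : M →ₗ[R] N) :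
    DualVia K σ N →ₗ[S] DualVia K σ M where
  toFun φ := ⟨(AddMonoidHomClass.toAddMonoidHom φ).comp j.toAddMonoidHom, fun c m => by
    change φ (j (algebraMap K R c • m)) = c * φ (j m)
    rw [_root_.map_smul, map_algebraMap_smul]⟩
  map_add' _ _ := rfl
  map_smul' s φ := DFunLike.ext _ _ fun m => by
    change φ ((σ s).unop • j m) = φ (j ((σ s).unop • m))
    rw [LinearMap.map_smul j]

end

section Flip

variable [Algebra K S] {M : Type*} [AddCommGroup M] [Module R M] {N : Type*} [AddCommGroup N]
  [Module S N]

/-- The adjunction `Hom_S(N, D M) → Hom_R(M, D N)`. -/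
def flip (τ : R ≃+* Sᵐᵒᵖ) (hσ : ∀ c, σ (algebraMap K S c) = MulOpposite.op (algebraMap K R c))
    (hστ : ∀ r, (σ (τ r).unop).unop = r) (f : N →ₗ[S] DualVia K σ M) : M →ₗ[R] DualVia K τ N where
  toFun m := ⟨{ toFun := fun n => f n m
                map_zero' := by rw [_root_.map_zero, zero_apply]
                map_add' := fun a b => by rw [_root_.map_add, add_apply] }, fun c n => by
      change f (algebraMap K S c • n) m = c * f n m
      rw [_root_.map_smul, smul_apply, hσ, MulOpposite.unop_op, map_algebraMap_smul]⟩
  map_add' a b := DFunLike.ext _ _ fun n => _root_.map_add (f n) a b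
  map_smul' r m := DFunLike.ext _ _ fun n => by
    change f n (r • m) = f ((τ r).unop • n) m
    rw [LinearMap.map_smul f, smul_apply, hστ]

theorem flip_apply (τ : R ≃+* Sᵐᵒᵖ)
    (hσ : ∀ c, σ (algebraMap K S c) = MulOpposite.op (algebraMap K R c))
    (hστ : ∀ r, (σ (τ r).unop).unop = r) (f : N →ₗ[S] DualVia K σ M) (m : M) (n : N) :
    flip τ hσ hστ f m n = f n m := rfl

/-- The dual of a projective module is injective. -/
theorem baer (τ : R ≃+* Sᵐᵒᵖ)
    (hσ : ∀ c, σ (algebraMap K S c) = MulOpposite.op (algebraMap K R c))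
    (hτ : ∀ c, τ (algebraMap K R c) = MulOpposite.op (algebraMap K S c))
    (hστ : ∀ r, (σ (τ r).unop).unop = r) (hτσ : ∀ s, (τ (σ s).unop).unop = s)
    (P : Type*) [AddCommGroup P] [Module R P] [Module.Projective R P] :
    Module.Baer S (DualVia K σ P) := by
  intro I g
  -- Duality turns extension from the ideal `I` to `S` into lifting along the surjection from the
  -- dual of `S` to the dual of `I`, which projectivity of `P` solves.
  obtain ⟨h, hh⟩ := Module.projective_lifting_property (map (K := K) τ I.subtype)
    (flip τ hσ hστ g) (fun φ => by
      obtain ⟨ψ, hψ⟩ := exists_extension I.subtype I.injective_subtype φ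
      exact ⟨ψ, DFunLike.ext _ _ hψ⟩)
  refine ⟨flip σ hτ hτσ h, fun x hx => DFunLike.ext _ _ fun p => ?_⟩
  rw [flip_apply]
  exact DFunLike.congr_fun (LinearMap.congr_fun hh p) ⟨x, hx⟩

/-- The dual of the regular module is a cogenerator: a functional `l` on `M` is the image of `1`
under a map from `S` to the dual of `M`, and the adjoint of that map is nonzero if `l` is. -/
theorem exists_ne_zero_hom (τ : R ≃+* Sᵐᵒᵖ)
    (hσ : ∀ c, σ (algebraMap K S c) = MulOpposite.op (algebraMap K R c))
    (hστ : ∀ r, (σ (τ r).unop).unop = r) (e : N ≃ₗ[S] S) [Nontrivial M] :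
    ∃ φ : M →ₗ[R] DualVia K τ N, φ ≠ 0 := by
  obtain ⟨m, hm⟩ := exists_ne (0 : M)
  obtain ⟨l, hl⟩ := exists_apply_ne_zero (K := K) (σ := σ) m hm
  refine ⟨flip τ hσ hστ (LinearMap.toSpanSingleton S _ l ∘ₗ e.toLinearMap), fun h => hl ?_⟩
  have h1 := DFunLike.congr_fun (LinearMap.congr_fun h m) (e.symm 1)
  rw [flip_apply] at h1
  simpa [zero_apply] using h1

/-- A functional on the dual of a finite-dimensional module is an evaluation. -/
theorem exists_eval [Module.Finite K S] [Module.Finite S N] (τ : R ≃+* Sᵐᵒᵖ)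
    (hτ : ∀ c, τ (algebraMap K R c) = MulOpposite.op (algebraMap K S c))
    (ξ : DualVia K σ (DualVia K τ N)) : ∃ n : N, ∀ φ, ξ φ = φ n := by
  let _ : Module K N := Module.compHom N (algebraMap K S)
  have : IsScalarTower K S N := IsScalarTower.of_compHom K S N
  have : Module.Finite K N := Module.Finite.trans S N
  choose D hD using fun l : N →ₗ[K] K => exists_of_linearMap (σ := τ) l
  let ξ' : Module.Dual K (Module.Dual K N) :=
    { toFun := fun l => ξ (D l)
      map_add' := fun l l' => by
        rw [← _root_.map_add]
        congr 1
        exact DFunLike.ext _ _ fun n => by rw [add_apply, hD, hD, hD, LinearMap.add_apply]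
      map_smul' := fun c l => by
        rw [RingHom.id_apply, smul_eq_mul, ← map_algebraMap_smul]
        congr 1
        refine DFunLike.ext _ _ fun n => ?_
        rw [smul_apply, hτ, MulOpposite.unop_op, map_algebraMap_smul, hD, hD, LinearMap.smul_apply,
          smul_eq_mul] }
  refine ⟨(Module.evalEquiv K N).symm ξ', fun φ => ?_⟩
  have h1 : Module.Dual.eval K N ((Module.evalEquiv K N).symm ξ') φ.toLinearMap =
      ξ' φ.toLinearMap := by
    rw [← Module.evalEquiv_toLinearMap, LinearEquiv.coe_coe, LinearEquiv.apply_symm_apply]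
  have h2 : D φ.toLinearMap = φ := DFunLike.ext _ _ fun n => by rw [hD, toLinearMap_apply]
  change φ ((Module.evalEquiv K N).symm ξ') = ξ (D φ.toLinearMap) at h1
  rw [h1, h2]

end Flip

end DualVia

/-! ### Self-injective dimension from a projective resolution of the dual -/

section InjectiveDimension

variable {K : Type w} [Field K] {R S : Type u} [Ring R] [Ring S] [Algebra K R] [Algebra K S]
  [Module.Finite K R]

/-- If the dual `T` of the regular `S`-module has projective dimension at most one over `R`, then
the regular module over `S` has injective dimension at most one. -/
theorem injectiveDimension_le_one_of_dual [Module.Finite K S] {σ : S ≃+* Rᵐᵒᵖ} (τ : R ≃+* Sᵐᵒᵖ)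
    (hσ : ∀ c, σ (algebraMap K S c) = MulOpposite.op (algebraMap K R c))
    (hτ : ∀ c, τ (algebraMap K R c) = MulOpposite.op (algebraMap K S c))
    (hστ : ∀ r, (σ (τ r).unop).unop = r) (hτσ : ∀ s, (τ (σ s).unop).unop = s)
    {U : Type u} [AddCommGroup U] [Module S U] [Module.Finite S U]
    {P₀ P₁ : Type u} [AddCommGroup P₀] [AddCommGroup P₁] [Module R P₀] [Module R P₁]
    [Module.Finite R P₀] [Module.Finite R P₁] [Module.Projective R P₀] [Module.Projective R P₁]
    (d : P₁ →ₗ[R] P₀) (π : P₀ →ₗ[R] DualVia K τ U) (hd : Function.Injective d)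
    (hex : Function.Exact d π) (hπ : Function.Surjective π) :
    injectiveDimension (ModuleCat.of.{u} S U) ≤ 1 := by
  -- The duals live in a universe depending on that of `K`; small copies are needed to form objects
  -- of the same module category as `U`.
  have : Small.{u} (DualVia K σ P₀) := Module.Finite.small.{u} S _
  have : Small.{u} (DualVia K σ P₁) := Module.Finite.small.{u} S _
  let e₀ := Shrink.linearEquiv.{u} S (DualVia K σ P₀)
  let e₁ := Shrink.linearEquiv.{u} S (DualVia K σ P₁)
  refine injectiveDimension_le_one_of_exact
    (e₀.symm.toLinearMap ∘ₗ DualVia.flip σ hτ hτσ π)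
    (e₁.symm.toLinearMap ∘ₗ DualVia.map σ d ∘ₗ e₀.toLinearMap) ?_ ?_ ?_
    ((DualVia.baer τ hσ hτ hστ hτσ P₀).of_equiv e₀.symm)
    ((DualVia.baer τ hσ hτ hστ hτσ P₁).of_equiv e₁.symm)
  · refine e₀.symm.injective.comp ?_
    rw [← LinearMap.ker_eq_bot, LinearMap.ker_eq_bot']
    intro x hx
    by_contra hx0
    obtain ⟨φ, hφ⟩ := DualVia.exists_apply_ne_zero (K := K) (σ := τ) x hx0
    obtain ⟨p, rfl⟩ := hπ φ
    exact hφ (DFunLike.congr_fun hx p)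
  · intro y
    obtain ⟨φ, rfl⟩ := e₀.symm.surjective y
    simp only [LinearMap.comp_apply, LinearEquiv.coe_coe, LinearEquiv.apply_symm_apply,
      LinearEquiv.map_eq_zero_iff]
    constructor
    · intro h
      have hker : ∀ p, π p = 0 → φ p = 0 := fun p hp => by
        obtain ⟨q, rfl⟩ := (hex p).1 hp
        exact DFunLike.congr_fun h q
      -- A set-theoretic section suffices: `φ` vanishes on `Ker π`, so `φ ∘ s` is additive and
      -- `K`-linear. Reflexivity of `U` then gives the preimage.
      choose s hs using hπ
      have hφ : ∀ p, φ (s (π p)) = φ p := fun p => by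
        rw [← sub_eq_zero, ← _root_.map_sub]
        exact hker _ (by rw [_root_.map_sub, hs, sub_self])
      let ξ : DualVia K σ (DualVia K τ U) :=
        ⟨{ toFun := fun ψ => φ (s ψ)
           map_zero' := hker _ (hs 0)
           map_add' := fun a b => by
            rw [← _root_.map_add, ← hφ (s a + s b), _root_.map_add π, hs, hs] }, fun c ψ => by
          change φ (s (algebraMap K R c • ψ)) = c * φ (s ψ)
          rw [← DualVia.map_algebraMap_smul, ← hφ (algebraMap K R c • s ψ), _root_.map_smul π, hs]⟩
      obtain ⟨x, hx⟩ := DualVia.exists_eval τ hτ ξ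
      refine ⟨x, congrArg e₀.symm (DFunLike.ext _ _ fun p => ?_)⟩
      rw [DualVia.flip_apply, ← hx]
      exact hφ p
    · rintro ⟨x, hx⟩
      rw [← e₀.symm.injective hx]
      refine DFunLike.ext _ _ fun q => ?_
      change π (d q) x = 0
      rw [hex.apply_apply_eq_zero]
      rfl
  · have hsurj : Function.Surjective (DualVia.map (K := K) σ d) := fun φ => by
      obtain ⟨ψ, hψ⟩ := DualVia.exists_extension d hd φ
      exact ⟨ψ, DFunLike.ext _ _ hψ⟩
    exact e₁.symm.surjective.comp (hsurj.comp e₀.surjective)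

/-- If the dual `T` of the regular `S`-module has projective dimension at most one over `R`, then
the regular module over `R` has injective dimension at most one. -/
theorem injectiveDimension_self_le_one_of_dual [Infinite K] {σ : S ≃+* Rᵐᵒᵖ} (τ : R ≃+* Sᵐᵒᵖ)
    (hσ : ∀ c, σ (algebraMap K S c) = MulOpposite.op (algebraMap K R c))
    (hτ : ∀ c, τ (algebraMap K R c) = MulOpposite.op (algebraMap K S c))
    (hστ : ∀ r, (σ (τ r).unop).unop = r) (hτσ : ∀ s, (τ (σ s).unop).unop = s)
    {U : Type u} [AddCommGroup U] [Module S U] (e : U ≃ₗ[S] S)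
    {P₀ P₁ : Type u} [AddCommGroup P₀] [AddCommGroup P₁] [Module R P₀] [Module R P₁]
    [Module.Finite R P₀] [Module.Finite R P₁] [Module.Projective R P₀] [Module.Projective R P₁]
    (d : P₁ →ₗ[R] P₀) (π : P₀ →ₗ[R] DualVia K τ U) (hd : Function.Injective d)
    (hex : Function.Exact d π) (hπ : Function.Surjective π) :
    injectiveDimension (ModuleCat.of.{u} R R) ≤ 1 := by
  have : Module.Projective S U := Module.Projective.of_equiv' e.symm
  let c : (P₀ ⧸ LinearMap.range d) ≃ₗ[R] DualVia K τ U :=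
    (Submodule.quotEquivOfEq _ _ (LinearMap.exact_iff.1 hex).symm).trans
      (π.quotKerEquivOfSurjective hπ)
  refine ProjectiveHom.injectiveDimension_self_le_one K { P := P₁, Q := P₀, f := d } hd
    ((DualVia.baer σ hτ hσ hτσ hστ U).of_equiv c.symm) fun M _ _ hM => ?_
  have := IsSimpleModule.nontrivial R M
  obtain ⟨φ, hφ⟩ := DualVia.exists_ne_zero_hom (K := K) (M := M) τ hσ hστ e
  refine ⟨c.symm.toLinearMap ∘ₗ φ, fun h => hφ (LinearMap.ext fun x => ?_)⟩
  exact c.symm.injective ((LinearMap.congr_fun h x).trans (_root_.map_zero c.symm).symm)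

end InjectiveDimension

/-! ### Indecomposable summands and primitive idempotents -/

section PrimitiveIdempotent

/-- A primitive idempotent. -/
structure IsPrimitiveIdempotent {E : Type*} [Ring E] (e : E) : Prop where
  idem : e * e = e
  ne_zero : e ≠ 0
  eq_or_eq : ∀ f : E, f * f = f → e * f = f → f * e = f → f = 0 ∨ f = e

/-- Murray–von Neumann equivalence of primitive idempotents. -/
def primitiveIdempotentSetoid (E : Type*) [Ring E] :
    Setoid {e : E // IsPrimitiveIdempotent e} where
  r e f := ∃ a b : E, a * b = e ∧ b * a = f
  iseqv :=
    { refl := fun e => ⟨e, e, e.2.idem, e.2.idem⟩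
      symm := fun ⟨a, b, h, h'⟩ => ⟨b, a, h', h⟩
      trans := by
        rintro ⟨e, he⟩ ⟨f, hf⟩ ⟨g, hg⟩ ⟨a, b, h, h'⟩ ⟨c, d, k, k'⟩
        dsimp only at h h' k k'
        refine ⟨a * c, d * b, ?_, ?_⟩
        · calc a * c * (d * b) = a * (c * d) * b := by simp only [mul_assoc]
            _ = (a * b) * (a * b) := by rw [k, ← h']; simp only [mul_assoc]
            _ = e := by rw [h, he.idem]
        · calc d * b * (a * c) = d * (b * a) * c := by simp only [mul_assoc]
            _ = (d * c) * (d * c) := by rw [h', ← k]; simp only [mul_assoc]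
            _ = g := by rw [k', hg.idem] }

theorem IsPrimitiveIdempotent.map {E F : Type*} [Ring E] [Ring F] (Φ : E ≃+* F) {e : E}
    (h : IsPrimitiveIdempotent e) : IsPrimitiveIdempotent (Φ e) where
  idem := by rw [← map_mul, h.idem]
  ne_zero := (map_ne_zero_iff Φ Φ.injective).2 h.ne_zero
  eq_or_eq f hf h₁ h₂ := by
    obtain ⟨f, rfl⟩ := Φ.surjective f
    simp only [← map_mul, Φ.injective.eq_iff] at hf h₁ h₂
    exact (h.eq_or_eq f hf h₁ h₂).imp (fun h => by rw [h, map_zero]) (fun h => by rw [h])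

variable {R : Type*} [Ring R] {M : Type*} [AddCommGroup M] [Module R M]

theorem apply_eq_of_mem_range {e : Module.End R M} (he : e * e = e) {x : M}
    (hx : x ∈ LinearMap.range e) : e x = x := by
  obtain ⟨y, rfl⟩ := hx
  exact LinearMap.congr_fun he y

/-- An idempotent `f` with `e f = f = f e` splits the range of `e` into the ranges of `f` and `e -
f`; conversely the projection of a splitting, precomposed with `e`, is such an `f`. -/
theorem isIndecomposableModule_range_iff {e : Module.End R M} (he : e * e = e) :
    IsIndecomposableModule R (LinearMap.range e) ↔ IsPrimitiveIdempotent e := by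
  have hmem : ∀ x, x ∈ LinearMap.range e → e x = x := fun x => apply_eq_of_mem_range he
  constructor
  · rintro ⟨hnt, h⟩
    refine ⟨he, ?_, fun f hf hef hfe => ?_⟩
    · rintro rfl
      rw [LinearMap.range_zero] at hnt
      exact not_subsingleton (⊥ : Submodule R M) inferInstance
    · have hff : ∀ x, f (f x) = f x := LinearMap.congr_fun hf
      have hef' : ∀ x, e (f x) = f x := LinearMap.congr_fun hef
      have hfe' : ∀ x, f (e x) = f x := LinearMap.congr_fun hfe
      have hee : ∀ x, e (e x) = e x := LinearMap.congr_fun he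
      have key := h ((LinearMap.range f).comap (LinearMap.range e).subtype)
        ((LinearMap.range (e - f)).comap (LinearMap.range e).subtype) (by
          constructor
          · rw [Submodule.disjoint_def]
            rintro ⟨x, hx⟩ hxf hxg
            obtain ⟨y, hy : f y = x⟩ := hxf
            obtain ⟨z, hz : e z - f z = x⟩ := hxg
            have h1 : f x = x := by rw [← hy, hff]
            have h2 : f x = 0 := by rw [← hz, _root_.map_sub, hfe', hff, sub_self]
            exact Subtype.ext (h1.symm.trans h2)
          · rw [codisjoint_iff, eq_top_iff]
            rintro ⟨x, hx⟩ -
            refine Submodule.mem_sup.2 ⟨⟨f x, f x, hef' x⟩, ⟨x, rfl⟩, ⟨e x - f x, x - f x, ?_⟩,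
              ⟨x, rfl⟩, Subtype.ext ?_⟩
            · rw [_root_.map_sub, hef']
            · change f x + (e x - f x) = x
              rw [add_sub_cancel, hmem x hx])
      refine key.imp (fun h0 => ?_) (fun h0 => ?_)
      · ext x
        have : (⟨f x, f x, hef' x⟩ : LinearMap.range e) ∈
            (LinearMap.range f).comap (LinearMap.range e).subtype := ⟨x, rfl⟩
        rw [h0] at this
        exact congrArg Subtype.val ((Submodule.mem_bot R).1 this)
      · ext x
        have : (⟨e x - f x, x - f x, by rw [_root_.map_sub, hef']⟩ : LinearMap.range e) ∈
            (LinearMap.range (e - f)).comap (LinearMap.range e).subtype := ⟨x, rfl⟩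
        rw [h0] at this
        exact (sub_eq_zero.1 (congrArg Subtype.val ((Submodule.mem_bot R).1 this))).symm
  · intro h
    constructor
    · obtain ⟨x, hx⟩ : ∃ x, e x ≠ 0 := by
        by_contra! h0
        exact h.ne_zero (LinearMap.ext h0)
      exact ⟨⟨e x, x, rfl⟩, 0, fun h0 => hx (congrArg Subtype.val h0)⟩
    · intro X Y hXY
      let p : LinearMap.range e →ₗ[R] LinearMap.range e :=
        X.subtype ∘ₗ Submodule.projectionOnto X Y hXY
      have hpX : ∀ x ∈ X, p x = x := fun x hx => by
        have := Submodule.projectionOnto_apply_left hXY ⟨x, hx⟩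
        exact congrArg Subtype.val this
      have hpY : ∀ x ∈ Y, p x = 0 := fun x hx => by
        have := (Submodule.projectionOnto_apply_eq_zero_iff hXY).2 hx
        exact congrArg Subtype.val this
      have hpp : ∀ x, p (p x) = p x := fun x => hpX _ (Submodule.projectionOnto X Y hXY x).2
      let f : Module.End R M := (LinearMap.range e).subtype ∘ₗ p ∘ₗ e.rangeRestrict
      have hr : ∀ x : LinearMap.range e, e.rangeRestrict x = x := fun x =>
        Subtype.ext (hmem x x.2)
      have hf : ∀ x : LinearMap.range e, f x = p x := fun x => by
        change ((p (e.rangeRestrict x) : LinearMap.range e) : M) = _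
        rw [hr]
      have hff : f * f = f := LinearMap.ext fun x => by
        change f (p (e.rangeRestrict x) : LinearMap.range e) = (p (e.rangeRestrict x) : M)
        rw [hf, hpp]
      have hef : e * f = f := LinearMap.ext fun x => hmem _ (p (e.rangeRestrict x)).2
      have hfe : f * e = f := LinearMap.ext fun x => by
        change (p (e.rangeRestrict (e x)) : M) = (p (e.rangeRestrict x) : M)
        rw [show e.rangeRestrict (e x) = e.rangeRestrict x from hr (e.rangeRestrict x)]
      rcases h.eq_or_eq f hff hef hfe with h0 | h0
      · left
        rw [eq_bot_iff]
        intro x hx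
        have h1 := hf x
        rw [h0, hpX x hx] at h1
        exact (Submodule.mem_bot R).2 (Subtype.ext h1.symm)
      · right
        rw [eq_bot_iff]
        intro x hx
        have h1 := hf x
        rw [h0, hpY x hx, hmem x x.2] at h1
        exact (Submodule.mem_bot R).2 (Subtype.ext h1)

theorem nonempty_range_equiv_iff {e f : Module.End R M} (he : e * e = e) (hf : f * f = f) :
    Nonempty (LinearMap.range e ≃ₗ[R] LinearMap.range f) ↔
      ∃ a b : Module.End R M, a * b = e ∧ b * a = f := by
  have hre : ∀ x : LinearMap.range e, e.rangeRestrict x = x := fun x =>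
    Subtype.ext (apply_eq_of_mem_range he x.2)
  have hrf : ∀ x : LinearMap.range f, f.rangeRestrict x = x := fun x =>
    Subtype.ext (apply_eq_of_mem_range hf x.2)
  constructor
  · rintro ⟨θ⟩
    refine ⟨(LinearMap.range e).subtype ∘ₗ θ.symm.toLinearMap ∘ₗ f.rangeRestrict,
      (LinearMap.range f).subtype ∘ₗ θ.toLinearMap ∘ₗ e.rangeRestrict, ?_, ?_⟩
    · ext x
      change (θ.symm (f.rangeRestrict (θ (e.rangeRestrict x))) : M) = e x
      rw [hrf, LinearEquiv.symm_apply_apply]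
      rfl
    · ext x
      change (θ (e.rangeRestrict (θ.symm (f.rangeRestrict x))) : M) = f x
      rw [hre, LinearEquiv.apply_symm_apply]
      rfl
  · rintro ⟨a, b, rfl, rfl⟩
    have h1 : ∀ x ∈ LinearMap.range (a * b), b x ∈ LinearMap.range (b * a) := fun x hx =>
      ⟨b x, congrArg b (apply_eq_of_mem_range he hx)⟩
    have h2 : ∀ x ∈ LinearMap.range (b * a), a x ∈ LinearMap.range (a * b) := fun x hx =>
      ⟨a x, congrArg a (apply_eq_of_mem_range hf hx)⟩
    exact ⟨LinearEquiv.ofLinearMap (b.restrict h1) (a.restrict h2)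
      (LinearMap.ext fun x => Subtype.ext (apply_eq_of_mem_range hf x.2))
      (LinearMap.ext fun x => Subtype.ext (apply_eq_of_mem_range he x.2))⟩

theorem isCompl_range_ker_of_idem {e : Module.End R M} (he : e * e = e) :
    IsCompl (LinearMap.range e) (LinearMap.ker e) := by
  constructor
  · rw [Submodule.disjoint_def]
    intro x hx hx'
    rw [← apply_eq_of_mem_range he hx, LinearMap.mem_ker.1 hx']
  · rw [codisjoint_iff, eq_top_iff]
    intro x _
    refine Submodule.mem_sup.2 ⟨e x, ⟨x, rfl⟩, x - e x, ?_, add_sub_cancel _ _⟩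
    rw [LinearMap.mem_ker, _root_.map_sub, sub_eq_zero]
    exact (LinearMap.congr_fun he x).symm

/-- Summands correspond to ranges of idempotents, indecomposability to primitivity and isomorphism
to equivalence, so the count can be read off the endomorphism ring. -/
theorem numIndecSummands_eq_card :
    numIndecSummands R M =
      ENat.card (Quotient (primitiveIdempotentSetoid (Module.End R M))) := by
  symm
  let F : {e : Module.End R M // IsPrimitiveIdempotent e} → IndecSummand R M := fun e =>
    ⟨LinearMap.range e.1, (isIndecomposableModule_range_iff e.2.idem).2 e.2, LinearMap.ker e.1,
      isCompl_range_ker_of_idem e.2.idem⟩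
  have hF : ∀ e f, (primitiveIdempotentSetoid (Module.End R M)) e f ↔
      (indecSummandSetoid R M) (F e) (F f) := fun e f =>
    (nonempty_range_equiv_iff e.2.idem f.2.idem).symm
  refine ENat.card_congr (Equiv.ofBijective
    (Quotient.map F fun e f h => (hF e f).1 h) ⟨?_, ?_⟩)
  · rintro ⟨e⟩ ⟨f⟩ h
    exact Quotient.sound ((hF e f).2 (Quotient.exact h))
  · rintro ⟨⟨N, hN, N', hNN'⟩⟩
    let e : Module.End R M := N.subtype ∘ₗ Submodule.projectionOnto N N' hNN'
    have heN : ∀ x ∈ N, e x = x := fun x hx =>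
      congrArg Subtype.val (Submodule.projectionOnto_apply_left hNN' ⟨x, hx⟩)
    have he : e * e = e := LinearMap.ext fun x =>
      heN _ (Submodule.projectionOnto N N' hNN' x).2
    have hr : LinearMap.range e = N := by
      apply le_antisymm
      · rintro _ ⟨x, rfl⟩
        exact (Submodule.projectionOnto N N' hNN' x).2
      · exact fun x hx => ⟨x, heN x hx⟩
    refine ⟨Quotient.mk _ ⟨e, (isIndecomposableModule_range_iff he).1 (hr.symm ▸ hN)⟩,
      Quotient.sound ⟨LinearEquiv.ofEq _ _ hr⟩⟩

/-- The number of indecomposable summands depends only on the endomorphism ring. -/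
theorem numIndecSummands_eq_of_ringEquiv {R' : Type*} [Ring R'] {M' : Type*} [AddCommGroup M']
    [Module R' M'] (Φ : Module.End R M ≃+* Module.End R' M') :
    numIndecSummands R M = numIndecSummands R' M' := by
  rw [numIndecSummands_eq_card, numIndecSummands_eq_card]
  refine ENat.card_congr (Quotient.congr (Φ.toEquiv.subtypeEquiv fun e =>
    ⟨fun h => h.map Φ, fun h => by simpa using h.map Φ.symm⟩) ?_)
  rintro ⟨e, he⟩ ⟨f, hf⟩
  constructor
  · rintro ⟨a, b, h, h'⟩
    exact ⟨Φ a, Φ b, (map_mul Φ a b).symm.trans (congrArg Φ h),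
      (map_mul Φ b a).symm.trans (congrArg Φ h')⟩
  · rintro ⟨a, b, h, h'⟩
    refine ⟨Φ.symm a, Φ.symm b, Φ.injective ?_, Φ.injective ?_⟩
    · rw [map_mul, RingEquiv.apply_symm_apply, RingEquiv.apply_symm_apply]
      exact h
    · rw [map_mul, RingEquiv.apply_symm_apply, RingEquiv.apply_symm_apply]
      exact h'

end PrimitiveIdempotent

/-! ### Minimal presentations of projectives and homomorphisms out of the transpose -/

namespace MinimalProjectivePresentation

variable {R : Type u} [Ring R] {M : Type w} [AddCommGroup M] [Module R M]

/-- The image of a section of `π` complements a superfluous kernel, hence is all of `P₀`. So `π` is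
injective, `d = 0`, and `P₁` is superfluous in itself. Consequently transposes of projectives
vanish. -/
theorem subsingleton_P₁ (p : MinimalProjectivePresentation R M) [Module.Projective R M] :
    Subsingleton p.P₁ := by
  obtain ⟨s, hs⟩ := Module.projective_lifting_property p.π LinearMap.id p.surjective
  have hs' : ∀ m, p.π (s m) = m := fun m => LinearMap.congr_fun hs m
  have htop : LinearMap.range s = ⊤ := p.superfluous₀ _ (by
    rw [eq_top_iff]
    intro x _
    refine Submodule.mem_sup.2 ⟨s (p.π x), ⟨_, rfl⟩, x - s (p.π x), ?_, add_sub_cancel _ _⟩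
    rw [LinearMap.mem_ker, map_sub, hs', sub_self])
  have hd : LinearMap.ker p.d = ⊤ := by
    rw [eq_top_iff]
    intro y _
    obtain ⟨m, hm⟩ := LinearMap.range_eq_top.1 htop (p.d y)
    have h0 : p.π (p.d y) = 0 := p.exact.apply_apply_eq_zero y
    rw [← hm, hs'] at h0
    rw [LinearMap.mem_ker, ← hm, h0, map_zero]
  have hbot : (⊥ : Submodule R p.P₁) = ⊤ := p.superfluous₁ ⊥ (by rw [hd, bot_sup_eq])
  exact subsingleton_of_forall_eq 0 fun y =>
    (Submodule.mem_bot R).1 (hbot.symm ▸ Submodule.mem_top : y ∈ (⊥ : Submodule R p.P₁))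

/-- If there are no nonzero homomorphisms from the transpose to the regular module, then the
presentation is injective. -/
theorem injective_d (p : MinimalProjectivePresentation R M) {S U : Type*} [Ring S]
    [AddCommGroup U] [Module R U] [Module S U] [SMulCommClass R S U] (e : R ≃ₗ[R] U)
    (h : ∀ f : p.CokerHom S U →ₗ[S] U, f = 0) : Function.Injective p.d := by
  rw [← LinearMap.ker_eq_bot, LinearMap.ker_eq_bot']
  intro x hx
  -- Evaluation at an element of `Ker d` descends to the transpose.
  let ev : (p.P₁ →ₗ[R] U) →ₗ[S] U :=
    { toFun := fun φ => φ x
      map_add' := fun _ _ => rfl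
      map_smul' := fun _ _ => rfl }
  have hev : LinearMap.range (LinearMap.lcomp S U p.d) ≤ LinearMap.ker ev := by
    rintro _ ⟨φ, rfl⟩
    change φ (p.d x) = 0
    rw [hx, map_zero]
  have hzero : ∀ φ : p.P₁ →ₗ[R] U, φ x = 0 := fun φ =>
    LinearMap.congr_fun (h (Submodule.liftQ _ ev hev)) (Submodule.Quotient.mk φ)
  -- `P₁` embeds in a free module, whose coordinates are homomorphisms to `R` and therefore kill
  -- `x`.
  obtain ⟨s, hs⟩ := (inferInstance : Module.Projective R p.P₁)
  have hsx : s x = 0 := Finsupp.ext fun y =>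
    e.injective ((hzero (e.toLinearMap ∘ₗ Finsupp.lapply y ∘ₗ s)).trans (map_zero e).symm)
  rw [← hs x, hsx, map_zero]

end MinimalProjectivePresentation

/-! ### The dual of the regular module and its endomorphism ring -/

section RegularDual

variable (K : Type w) [Field K] (A : Type u) [Ring A] [Algebra K A]

/-- The regular right module. -/
def opLinearEquivSelf : Aᵐᵒᵖ ≃ₗ[Aᵐᵒᵖ] A where
  toFun a := a.unop
  invFun a := MulOpposite.op a
  map_add' _ _ := rfl
  map_smul' _ _ := rfl
  left_inv _ := rfl
  right_inv _ := rfl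

instance finite_op_self : Module.Finite Aᵐᵒᵖ A := Module.Finite.equiv (opLinearEquivSelf A)

/-- Left multiplications, acting on the dual of the regular left module. -/
def regularDualHom : A →+* Module.End Aᵐᵒᵖ (StdDual K A A) where
  toFun a := DualVia.map (K := K) (RingEquiv.refl Aᵐᵒᵖ) (LinearMap.toSpanSingleton A A a)
  map_zero' := LinearMap.ext fun φ => DFunLike.ext _ _ fun x => by
    exact (congrArg φ (mul_zero x)).trans (map_zero φ)
  map_one' := LinearMap.ext fun φ => DFunLike.ext _ _ fun x => congrArg φ (mul_one x)
  map_add' a b := LinearMap.ext fun φ => DFunLike.ext _ _ fun x => by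
    exact (congrArg φ (mul_add x a b)).trans (map_add φ _ _)
  map_mul' a b := LinearMap.ext fun φ => DFunLike.ext _ _ fun x =>
    congrArg φ (mul_assoc x a b).symm

theorem regularDualHom_apply (a : A) (φ : StdDual K A A) (x : A) :
    regularDualHom K A a φ x = φ (x * a) := rfl

theorem regularDualHom_bijective [Module.Finite K A] : Function.Bijective (regularDualHom K A) := by
  constructor
  · rw [injective_iff_map_eq_zero]
    intro a ha
    by_contra h0
    obtain ⟨φ, hφ⟩ := DualVia.exists_apply_ne_zero (K := K) (σ := RingEquiv.refl Aᵐᵒᵖ) a h0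
    have h1 : φ (1 * a) = 0 := DFunLike.congr_fun (LinearMap.congr_fun ha φ) 1
    rw [one_mul] at h1
    exact hφ h1
  · intro f
    -- An endomorphism `f` is determined by the functional `φ ↦ f φ 1`, because `f φ x` is its value
    -- at `φ x`. By reflexivity this functional is evaluation at some `a`.
    let ξ : DualVia K (RingEquiv.opOp A) (DualVia K (RingEquiv.refl Aᵐᵒᵖ) A) :=
      ⟨{ toFun := fun φ => f φ 1
         map_zero' := by
          change f 0 1 = 0
          rw [map_zero]
          rfl
         map_add' := fun (φ ψ : StdDual K A A) => by
          change f (φ + ψ) 1 = f φ 1 + f ψ 1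
          rw [map_add]
          rfl }, fun c (φ : StdDual K A A) => by
        change f (algebraMap K Aᵐᵒᵖ c • φ) 1 = c * f φ 1
        rw [LinearMap.map_smul f]
        exact StdDual.map_smul (f φ) c 1⟩
    obtain ⟨a, ha⟩ := DualVia.exists_eval (RingEquiv.refl Aᵐᵒᵖ) (fun _ => rfl) ξ
    refine ⟨a, LinearMap.ext fun φ => DFunLike.ext _ _ fun x => ?_⟩
    have h1 : f (MulOpposite.op x • φ) 1 = (MulOpposite.op x • φ : StdDual K A A) a := ha _
    rw [LinearMap.map_smul f, StdDual.op_smul_apply, StdDual.op_smul_apply, smul_eq_mul,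
      smul_eq_mul, mul_one] at h1
    rw [regularDualHom_apply, h1]

theorem numIndecSummands_regularDual [Module.Finite K A] {T : Type*} [AddCommGroup T] [Module Aᵐᵒᵖ T]
    (e : T ≃ₗ[Aᵐᵒᵖ] StdDual K A A) :
    numIndecSummands Aᵐᵒᵖ T = numIndecSummands Aᵐᵒᵖ A :=
  numIndecSummands_eq_of_ringEquiv (e.conjRingEquiv.trans
    ((RingEquiv.ofBijective _ (regularDualHom_bijective K A)).symm.trans
      (RingEquiv.moduleEndSelfOp A)))

/-- The double dual of the regular left module is projective. -/
theorem projective_dual_of_equiv [Module.Finite K A] {T : Type*} [AddCommGroup T] [Module Aᵐᵒᵖ T]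
    (e : T ≃ₗ[Aᵐᵒᵖ] StdDual K A A) : Module.Projective A (StdDual K Aᵐᵒᵖ T) := by
  let F : A →ₗ[A] StdDual K Aᵐᵒᵖ T :=
    DualVia.flip (RingEquiv.opOp A) (σ := RingEquiv.refl Aᵐᵒᵖ) (fun _ => rfl) (fun _ => rfl)
      (M := A) (K := K) e.toLinearMap
  have hF : ∀ a t, F a t = e t a := fun _ _ => rfl
  refine Module.Projective.of_equiv' (LinearEquiv.ofBijective F ⟨?_, fun ξ => ?_⟩)
  · rw [← LinearMap.ker_eq_bot, LinearMap.ker_eq_bot']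
    intro a ha
    by_contra h0
    obtain ⟨φ, hφ⟩ := DualVia.exists_apply_ne_zero (K := K) (σ := RingEquiv.refl Aᵐᵒᵖ) a h0
    obtain ⟨t, ht⟩ := e.surjective φ
    apply hφ
    have h1 : F a t = 0 := DFunLike.congr_fun ha t
    rw [hF, ht] at h1
    exact h1
  · obtain ⟨a, ha⟩ := DualVia.exists_eval (K := K) (σ := RingEquiv.opOp A) (N := A)
      (RingEquiv.refl Aᵐᵒᵖ) (fun _ => rfl)
      (DualVia.map (RingEquiv.opOp A) e.symm.toLinearMap ξ)
    refine ⟨a, DFunLike.ext _ _ fun t => ?_⟩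
    have h1 : ξ (e.symm (e t)) = e t a := ha (e t)
    rw [LinearEquiv.symm_apply_apply] at h1
    rw [hF, h1]

end RegularDual

/-! ### Rigidity of the regular module or its dual, and the main theorem -/

section Tilting

variable {K : Type w} [Field K] {A : Type u} [Ring A] [Algebra K A] [Module.Finite K A]

theorem isTauTilting_self : IsTauTilting K A A := by
  refine ⟨fun f => ?_, rfl⟩
  have : Module.Projective Aᵐᵒᵖ A := Module.Projective.of_equiv' (opLinearEquivSelf A)
  have := (MinimalProjectivePresentation.choice K Aᵐᵒᵖ A).subsingleton_P₁
  have : Subsingleton (TrRight K A A) := (Submodule.mkQ_surjective _).subsingleton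
  refine LinearMap.ext fun x => DFunLike.ext _ _ fun y => ?_
  rw [Subsingleton.elim y 0, StdDual.map_zero, StdDual.map_zero]

/-- The dual of `T` is projective, so `τ⁻¹T = 0`. A copy `T` replaces the dual of `A`, whose
universe may be too large. -/
theorem isTauInvTilting_of_equiv {T : Type u} [AddCommGroup T] [Module Aᵐᵒᵖ T]
    [Module.Finite Aᵐᵒᵖ T] (e : T ≃ₗ[Aᵐᵒᵖ] StdDual K A A) : IsTauInvTilting K A T := by
  refine ⟨fun f => ?_, numIndecSummands_regularDual K A e⟩
  have := projective_dual_of_equiv K A e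
  have := (MinimalProjectivePresentation.choice K A (StdDual K Aᵐᵒᵖ T)).subsingleton_P₁
  have : Subsingleton (InvARTranslate K A T) := (Submodule.mkQ_surjective _).subsingleton
  refine LinearMap.ext fun x => ?_
  rw [Subsingleton.elim x 0, map_zero, map_zero]

/-- If the regular right module is `τ⁻¹`-rigid, then both self-injective dimensions are at most
one. -/
theorem selfInjDim_le_one_of_isTauInvRigid [Infinite K] (h : IsTauInvRigid K A A) :
    leftSelfInjDim A ≤ 1 ∧ rightSelfInjDim A ≤ 1 := by
  let p := MinimalProjectivePresentation.choice K A (StdDual K Aᵐᵒᵖ A)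
  have hd : Function.Injective p.d := p.injective_d (S := Aᵐᵒᵖ) (LinearEquiv.refl A A) h
  exact ⟨injectiveDimension_self_le_one_of_dual (K := K) (σ := RingEquiv.refl Aᵐᵒᵖ)
      (RingEquiv.opOp A) (fun _ => rfl) (fun _ => rfl) (fun _ => rfl) (fun _ => rfl)
      (opLinearEquivSelf A).symm p.d p.π hd p.exact p.surjective,
    injectiveDimension_le_one_of_dual (K := K) (σ := RingEquiv.refl Aᵐᵒᵖ)
      (RingEquiv.opOp A) (fun _ => rfl) (fun _ => rfl) (fun _ => rfl) (fun _ => rfl)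
      p.d p.π hd p.exact p.surjective⟩

/-- If the dual of the regular left module is `τ`-rigid, then both self-injective dimensions are at
most one. -/
theorem selfInjDim_le_one_of_isTauRigid [Infinite K] {T : Type u} [AddCommGroup T]
    [Module Aᵐᵒᵖ T] [Module.Finite Aᵐᵒᵖ T] (e : T ≃ₗ[Aᵐᵒᵖ] StdDual K A A)
    (h : IsTauRigid K A T) : leftSelfInjDim A ≤ 1 ∧ rightSelfInjDim A ≤ 1 := by
  let p := MinimalProjectivePresentation.choice K Aᵐᵒᵖ T
  have hd : Function.Injective p.d := by
    refine p.injective_d (S := A) (opLinearEquivSelf A) fun g => LinearMap.ext fun c => ?_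
    by_contra h0
    obtain ⟨φ, hφ⟩ := DualVia.exists_apply_ne_zero (K := K) (σ := RingEquiv.refl Aᵐᵒᵖ) (g c) h0
    obtain ⟨t, rfl⟩ := e.surjective φ
    -- Dualizing `g : Tr T → A` gives `𝔻A → τT`, zero by rigidity; as functionals separate points,
    -- `g = 0`.
    let D : StdDual K A A →ₗ[Aᵐᵒᵖ] ARTranslate K A T :=
      DualVia.map (K := K) (RingEquiv.refl Aᵐᵒᵖ) g
    exact hφ (DFunLike.congr_fun (LinearMap.congr_fun (h (D ∘ₗ e.toLinearMap)) t) c)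
  have hex : Function.Exact p.d (e.toLinearMap ∘ₗ p.π) := fun y => by
    rw [← p.exact y]
    exact e.map_eq_zero_iff
  have hsurj : Function.Surjective (e.toLinearMap ∘ₗ p.π) := e.surjective.comp p.surjective
  have h1 : injectiveDimension (ModuleCat.of.{u} Aᵐᵒᵖ Aᵐᵒᵖ) ≤ 1 :=
    injectiveDimension_self_le_one_of_dual (K := K) (σ := RingEquiv.opOp A)
      (RingEquiv.refl Aᵐᵒᵖ) (fun _ => rfl) (fun _ => rfl) (fun _ => rfl) (fun _ => rfl)
      (LinearEquiv.refl A A) p.d (e.toLinearMap ∘ₗ p.π) hd hex hsurj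
  refine ⟨injectiveDimension_le_one_of_dual (K := K) (σ := RingEquiv.opOp A)
      (RingEquiv.refl Aᵐᵒᵖ) (fun _ => rfl) (fun _ => rfl) (fun _ => rfl) (fun _ => rfl)
      p.d (e.toLinearMap ∘ₗ p.π) hd hex hsurj, ?_⟩
  rwa [injectiveDimension_eq_of_iso (opLinearEquivSelf A).toModuleIso] at h1

end Tilting

theorem corollary2p5 {K : Type w} [Field K] [IsAlgClosed K]
    {A : Type u} [Ring A] [Algebra K A] [Module.Finite K A]
    (h : (∀ (T : Type u) [AddCommGroup T] [Module Aᵐᵒᵖ T] [Module.Finite Aᵐᵒᵖ T],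
            IsTauTilting K A T → IsTauInvTilting K A T) ∨
         (∀ (T : Type u) [AddCommGroup T] [Module Aᵐᵒᵖ T] [Module.Finite Aᵐᵒᵖ T],
            IsTauInvTilting K A T → IsTauTilting K A T)) :
    IsIwanagaGorenstein A ∧ rightSelfInjDim A ≤ 1 := by
  have : Infinite K := IsAlgClosed.instInfinite
  suffices H : leftSelfInjDim A ≤ 1 ∧ rightSelfInjDim A ≤ 1 by
    have h1 : (1 : WithBot ℕ∞) < ⊤ := by decide
    exact ⟨⟨H.2.trans_lt h1, H.1.trans_lt h1⟩, H.2⟩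
  rcases h with h | h
  · exact selfInjDim_le_one_of_isTauInvRigid (h A isTauTilting_self).1
  -- The hypothesis only concerns modules in `Type u`, so it is applied to a small copy of the dual.
  · have : Small.{u} (StdDual K A A) := Module.Finite.small.{u} Aᵐᵒᵖ _
    let e := Shrink.linearEquiv.{u} Aᵐᵒᵖ (StdDual K A A)
    exact selfInjDim_le_one_of_isTauRigid e (h _ (isTauInvTilting_of_equiv e)).1
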